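/- \textbf{Theorem (Nonexistence and triviality for $C^1$ radial solutions).} Let $n\ge 2$ be an integer, $0<R<\infty$, $1<p<\infty$, $0<l<p$, $\theta\in(0,1]$, and $B=B(0,R)\subset\mathbb{R}^n$. Put $\Phi_p(\xi)=|\xi|^{p-2}\xi$ for $\xi\neq 0$ and $\Phi_p(0)=0$. For a function space $F$ write $f\in F_{loc}([0,R))$ if $f\in F((0,r))$ for every $0<r<R$. For an a.e. positive $v$ and a nonnegative $q$ on $(0,R)$ put $$K(0,r,q,v)=\Big(\tfrac{p-l}{p}\Big)^{\frac{p-l}{p}}\Big[\int_0^r q(t)^{\frac pl}\,v(t)^{-\frac{p-l}{l}}\Big(\int_0^t v(s)^{-\frac1{p-1}}ds\Big)^{p-1}dt\Big]^{\frac lp}\in[0,\infty].$$ Let $a\in W^{1,1}_{loc}([0,R))$ with weak derivative $a'$, and let $$\delta_a(\tau)=(n-1)\frac{a(\tau)}{\tau}-\Big(1-\frac1p\Big)a'(\tau),\qquad d_a(\tau)=(n-1)\frac{a(\tau)}{\tau}+\frac1p a'(\tau).$$ For $v\in\{\delta_a,d_a\}$ consider the following set of conditions $\mathcal{N}(v)$: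 \begin{itemize} \item $\phi:\mathbb{R}\to\mathbb{R}$ is continuous and odd, and $\tau\phi(\tau)>0$ for a.e. $\tau$; \item $a>0$ and $v>0$ a.e. on $(0,R)$, and $v,\ v^{-1/(p-1)}\in L^1_{loc}([0,R))$; \item $q\ge 0$ a.e. on $(0,R)$, $q\in L^1_{loc}([0,R))$, and $h:(0,R)\times\mathbb{R}^2\to\mathbb{R}$ is a Carath\'eodory function (measurable in the first variable, continuous in the last two for a.e. value of the first) such that for a.e. $\tau\in(0,R)$ and all $\lambda_0,\lambda_1\in\mathbb{R}$ $$h(\tau,\lambda_0,\lambda_1)\lambda_1\le\theta\,q(\tau)|\lambda_0|^l|\lambda_1|^{p-l}+(1-\theta)\,v(\tau)|\lambda_1|^p;$$ \item $K(0,r,q,v)<\infty$ for every $0<r<R$. \end{itemize} Set $\mathcal{N}_{nd}=\mathcal{N}(\delta_a)$ and $\mathcal{N}_{d}=\mathcal{N}(d_a)$. Let $w\in C^1(B)$ be radial with $w(0)=0$ and $\Phi_p(\nabla w)\in W^{1,1}_{loc}(B,|x|^{-(n-1)}dx)$, that is, $\Phi_p(\nabla w)$ and its weak first derivatives are integrable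 with respect to $|x|^{-(n-1)}dx$ on $B(0,r)$ for every $0<r<R$. Suppose that one of the following holds: \begin{itemize} \item[$(\mathcal{ND}_n)$] $\mathcal{N}_{nd}$ is satisfied and $-a(|x|)\,\mathrm{div}\big(|\nabla w|^{p-2}\nabla w\big)+h\big(|x|,w,\langle\nabla w,\tfrac{x}{|x|}\rangle\big)=\phi(w)$ in $\mathcal{D}'(B)$; \item[$(\mathcal{D}_n)$] $\mathcal{N}_{d}$ is satisfied and $-\mathrm{div}\big(a(|x|)|\nabla w|^{p-2}\nabla w\big)+h\big(|x|,w,\langle\nabla w,\tfrac{x}{|x|}\rangle\big)=\phi(w)$ in $\mathcal{D}'(B)$. \end{itemize} (In both equations the function $x\mapsto h(|x|,w(x),\langle\nabla w(x),x/|x|\rangle)$ is understood to be locally integrable on $B$.) Then $w\equiv 0$ on $B$. In particular, if $h(\cdot,0,0)\ne 0$ on a subset of $(0,R)$ of positive measure, then no such $w$ exists. -/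

import Mathlib

open Set MeasureTheory TopologicalSpace
open scoped ENNReal Distributions Gradient

noncomputable section

namespace RadialPLaplace

/-! ### Weak derivatives and local spaces -/

/-- `g` is the weak derivative of `f` in the direction `v` on the open set `Ω`. -/
structure HasWeakLineDeriv {E : Type*} [NormedAddCommGroup E] [NormedSpace ℝ E]
    [MeasureSpace E] (Ω : Opens E) (v : E) (f g : E → ℝ) : Prop where
  locallyIntegrableOn : LocallyIntegrableOn f (Ω : Set E)
  locallyIntegrableOn_deriv : LocallyIntegrableOn g (Ω : Set E)
  integral_eq : ∀ ψ : 𝓓(Ω, ℝ),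
    ∫ x in (Ω : Set E), f x * fderiv ℝ ψ x v = - ∫ x in (Ω : Set E), g x * ψ x

/-- `g` is the weak divergence of the vector field `F` on the open set `Ω`. -/
structure HasWeakDiv {n : ℕ} (Ω : Opens (EuclideanSpace ℝ (Fin n)))
    (F : EuclideanSpace ℝ (Fin n) → EuclideanSpace ℝ (Fin n))
    (g : EuclideanSpace ℝ (Fin n) → ℝ) : Prop where
  locallyIntegrableOn : LocallyIntegrableOn F (Ω : Set (EuclideanSpace ℝ (Fin n)))
  locallyIntegrableOn_div : LocallyIntegrableOn g (Ω : Set (EuclideanSpace ℝ (Fin n)))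
  integral_eq : ∀ ψ : 𝓓(Ω, ℝ),
    ∫ x in (Ω : Set (EuclideanSpace ℝ (Fin n))), inner ℝ (F x) (∇ (ψ : _ → ℝ) x)
      = - ∫ x in (Ω : Set (EuclideanSpace ℝ (Fin n))), g x * ψ x

/-- The open interval `(s, r)`. -/
def interval (s r : ℝ) : Opens ℝ := ⟨Ioo s r, isOpen_Ioo⟩

/-- The open ball `B(0, R)` in `ℝⁿ`. -/
def oball (n : ℕ) (R : ℝ) : Opens (EuclideanSpace ℝ (Fin n)) :=
  ⟨Metric.ball 0 R, Metric.isOpen_ball⟩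

/-- `f ∈ L¹_loc([0, R))`, the intersection of the spaces `L¹((0, r))` over `0 < r < R`. -/
def MemL1Loc (R : ℝ) (f : ℝ → ℝ) : Prop :=
  ∀ r : ℝ, 0 < r → r < R → IntegrableOn f (Ioo 0 r)

/-- `f ∈ W^{1,1}_loc([0, R))`, the intersection of the spaces `W^{1,1}((0, r))` over
`0 < r < R`, and `f'` is (a representative of) its weak derivative. -/
def MemW11Loc (R : ℝ) (f f' : ℝ → ℝ) : Prop :=
  ∀ r : ℝ, 0 < r → r < R →
    IntegrableOn f (Ioo 0 r) ∧ IntegrableOn f' (Ioo 0 r) ∧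
      HasWeakLineDeriv (interval 0 r) 1 f f'

/-- The weighted measure `|x|^{-(n-1)} dx` on `ℝⁿ`. -/
def weightedVolume (n : ℕ) : Measure (EuclideanSpace ℝ (Fin n)) :=
  volume.withDensity fun x => ENNReal.ofReal (‖x‖ ^ (-((n : ℝ) - 1)))

/-- The vector field `F` belongs to `W^{1,1}_loc(B(0,R), |x|^{-(n-1)} dx)`: its components and
their weak partial derivatives `∂ⱼ Fᵢ = G i j` are locally integrable for the weighted
measure. -/
def MemWeightedW11Loc {n : ℕ} (R : ℝ)
    (F : EuclideanSpace ℝ (Fin n) → EuclideanSpace ℝ (Fin n)) : Prop :=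
  ∃ G : Fin n → Fin n → EuclideanSpace ℝ (Fin n) → ℝ,
    (∀ i j, HasWeakLineDeriv (oball n R) (EuclideanSpace.single j 1) (fun x => F x i) (G i j)) ∧
    ∀ r : ℝ, 0 < r → r < R →
      IntegrableOn F (Metric.ball 0 r) (weightedVolume n) ∧
      ∀ i j, IntegrableOn (G i j) (Metric.ball 0 r) (weightedVolume n)

/-! ### The structural assumptions -/

/-- `Φ_p(ξ) = |ξ|^{p-2} ξ`, with `Φ_p(0) = 0`. -/
def Phi {n : ℕ} (p : ℝ) (ξ : EuclideanSpace ℝ (Fin n)) : EuclideanSpace ℝ (Fin n) :=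
  ‖ξ‖ ^ (p - 2) • ξ

/-- `δ_a(τ) = (n-1) a(τ)/τ - (1 - 1/p) a'(τ)`. -/
def deltaA (n p : ℝ) (a a' : ℝ → ℝ) (τ : ℝ) : ℝ :=
  (n - 1) * (a τ / τ) - (1 - 1 / p) * a' τ

/-- `d_a(τ) = (n-1) a(τ)/τ + (1/p) a'(τ)`. -/
def dA (n p : ℝ) (a a' : ℝ → ℝ) (τ : ℝ) : ℝ :=
  (n - 1) * (a τ / τ) + 1 / p * a' τ

/-- The quantity `K(s, r, q, v)`, with values in `[0, ∞]`. -/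
def opialK (p l s r : ℝ) (q v : ℝ → ℝ) : ℝ≥0∞ :=
  ENNReal.ofReal (((p - l) / p) ^ ((p - l) / p)) *
    (∫⁻ t in Ioo s r,
      ENNReal.ofReal (q t) ^ (p / l) * ENNReal.ofReal (v t) ^ (-((p - l) / l)) *
        (∫⁻ τ in Ioo s t, ENNReal.ofReal (v τ) ^ (-(1 / (p - 1)))) ^ (p - 1)) ^ (l / p)

/-- Assumptions on the numbers. -/
structure CondNumbers (n p l R : ℝ) : Prop where
  one_lt_p : 1 < p
  l_pos : 0 < l
  l_lt_p : l < p
  one_le_n : 1 ≤ n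
  R_pos : 0 < R

/-- Assumptions on `φ`. -/
structure CondPhi (φ : ℝ → ℝ) : Prop where
  continuous : Continuous φ
  odd : ∀ t, φ (-t) = -φ t
  sign : ∀ᵐ t, 0 < t * φ t

/-- Assumptions on the weight `a` (with weak derivative `a'`) and on the function `v`, which
will be `δ_a` or `d_a`. -/
structure CondWeight (p R : ℝ) (a a' v : ℝ → ℝ) : Prop where
  memW11Loc : MemW11Loc R a a'
  pos : ∀ᵐ τ ∂volume.restrict (Ioo 0 R), 0 < a τ
  v_pos : ∀ᵐ τ ∂volume.restrict (Ioo 0 R), 0 < v τ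
  v_memL1Loc : MemL1Loc R v
  v_rpow_memL1Loc : MemL1Loc R fun τ => v τ ^ (-(1 / (p - 1)))

/-- Assumptions on `h` (a Carathéodory function with a one-sided growth bound). -/
structure CondGrowth (p l R θ : ℝ) (q v : ℝ → ℝ) (h : ℝ → ℝ → ℝ → ℝ) : Prop where
  measurable : ∀ y z, AEMeasurable (fun τ => h τ y z) (volume.restrict (Ioo 0 R))
  continuous : ∀ᵐ τ ∂volume.restrict (Ioo 0 R), Continuous fun y : ℝ × ℝ => h τ y.1 y.2
  θ_pos : 0 < θ
  θ_le_one : θ ≤ 1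
  q_nonneg : ∀ᵐ τ ∂volume.restrict (Ioo 0 R), 0 ≤ q τ
  q_memL1Loc : MemL1Loc R q
  bound : ∀ᵐ τ ∂volume.restrict (Ioo 0 R), ∀ y z : ℝ,
    h τ y z * z ≤ θ * (q τ * |y| ^ l * |z| ^ (p - l)) + (1 - θ) * (v τ * |z| ^ p)

/-- All structural assumptions, for a given choice of `v`. -/
structure CondN (n p l R θ : ℝ) (φ a a' q v : ℝ → ℝ) (h : ℝ → ℝ → ℝ → ℝ) : Prop where
  numbers : CondNumbers n p l R
  phi : CondPhi φ
  weight : CondWeight p R a a' v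
  growth : CondGrowth p l R θ q v h
  opialK_lt_top : ∀ r : ℝ, 0 < r → r < R → opialK p l 0 r q v < ∞

/-- The set of conditions `𝒩_nd`. -/
def CondNnd (n p l R θ : ℝ) (φ a a' q : ℝ → ℝ) (h : ℝ → ℝ → ℝ → ℝ) : Prop :=
  CondN n p l R θ φ a a' q (deltaA n p a a') h

/-- The set of conditions `𝒩_d`. -/
def CondNd (n p l R θ : ℝ) (φ a a' q : ℝ → ℝ) (h : ℝ → ℝ → ℝ → ℝ) : Prop :=
  CondN n p l R θ φ a a' q (dA n p a a') h

/-! ### The equations -/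

/-- The term `h(|x|, w(x), ⟨∇w(x), x/|x|⟩)`. -/
def hTerm {n : ℕ} (h : ℝ → ℝ → ℝ → ℝ) (w : EuclideanSpace ℝ (Fin n) → ℝ)
    (x : EuclideanSpace ℝ (Fin n)) : ℝ :=
  h ‖x‖ (w x) (inner ℝ (∇ w x) (‖x‖⁻¹ • x))

/-- `-a(|x|) div(|∇w|^{p-2} ∇w) + h(|x|, w, ⟨∇w, x/|x|⟩) = φ(w)` in `𝒟'(B(0,R))`, the
divergence `D` being a locally integrable function. -/
def SolvesNonDiv {n : ℕ} (p R : ℝ) (φ a : ℝ → ℝ) (h : ℝ → ℝ → ℝ → ℝ)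
    (w : EuclideanSpace ℝ (Fin n) → ℝ) : Prop :=
  ∃ D : EuclideanSpace ℝ (Fin n) → ℝ,
    HasWeakDiv (oball n R) (fun x => Phi p (∇ w x)) D ∧
    LocallyIntegrableOn (fun x => a ‖x‖ * D x) (Metric.ball 0 R) ∧
    LocallyIntegrableOn (hTerm h w) (Metric.ball 0 R) ∧
    ∀ ψ : 𝓓(oball n R, ℝ),
      ∫ x in Metric.ball 0 R, (-(a ‖x‖ * D x) + hTerm h w x) * ψ x
        = ∫ x in Metric.ball 0 R, φ (w x) * ψ x

/-- `-div(a(|x|) |∇w|^{p-2} ∇w) + h(|x|, w, ⟨∇w, x/|x|⟩) = φ(w)` in `𝒟'(B(0,R))`. -/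
def SolvesDiv {n : ℕ} (p R : ℝ) (φ a : ℝ → ℝ) (h : ℝ → ℝ → ℝ → ℝ)
    (w : EuclideanSpace ℝ (Fin n) → ℝ) : Prop :=
  LocallyIntegrableOn (fun x => a ‖x‖ • Phi p (∇ w x)) (Metric.ball 0 R) ∧
  LocallyIntegrableOn (hTerm h w) (Metric.ball 0 R) ∧
  ∀ ψ : 𝓓(oball n R, ℝ),
    ∫ x in Metric.ball 0 R,
        (inner ℝ (a ‖x‖ • Phi p (∇ w x)) (∇ (ψ : _ → ℝ) x) + hTerm h w x * ψ x)
      = ∫ x in Metric.ball 0 R, φ (w x) * ψ x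

/-- `w ∈ C¹(B(0,R))` is radial, `w(0) = 0` and
`Φ_p(∇w) ∈ W^{1,1}_loc(B(0,R), |x|^{-(n-1)} dx)`. -/
structure IsAdmissible {n : ℕ} (p R : ℝ) (w : EuclideanSpace ℝ (Fin n) → ℝ) : Prop where
  contDiffOn : ContDiffOn ℝ 1 w (Metric.ball 0 R)
  radial : ∃ u : ℝ → ℝ, ∀ x ∈ Metric.ball 0 R, w x = u ‖x‖
  map_zero : w 0 = 0
  memWeightedW11Loc : MemWeightedW11Loc R fun x => Phi p (∇ w x)

end RadialPLaplace

end

/-!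
# Radial solutions of equations with the `p`-Laplacian vanish

A radial solution is `w(x) = u(|x|)` with `u` of class `C¹`, and `u(0) = 0`; as `u` is even, the
derivative `y = u'` also vanishes at `0`. Write `Φ(z) = |z|^{p-2} z`, and let `α` be the absolutely
continuous representative of the weight `a`.

**The equation for the profile.** Testing with radial functions and passing to polar coordinates,
the du Bois-Reymond lemma (`ae_eq_primitive_of_weakDeriv`) shows that, away from the origin, the
flux `α Φ(y)` is absolutely continuous. For both equations its derivative is
`b = h(τ, u, y) - φ(u) - (v - a'/p) Φ(y)`, with `v = δ_a` or `v = d_a` (`fluxDeriv`). In the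
non-divergence case the weak divergence need not be radial a priori, but the equation expresses it
almost everywhere through radial functions, since `a > 0`.

**The energy identity.** Formally, multiplying by `y` gives
`((p-1)/p) (α |y|^p)' = y b - a' |y|^p / p`. The absolute continuity of the flux
does not pass to `y` where `α` vanishes, so the identity (`energy_identity`) is obtained from the
one for `|α Φ(y)|^{p'} (α + ε)^{1-p'}` with `p' = p/(p-1)`, which involves absolutely continuous
functions only, by letting `ε` tend to `0`. The growth condition on `h` and the sign
of `φ` then yield, if `u` vanishes on `[0, s]`,
`∫_s^t v |y|^p ≤ ∫_s^t q |u|^l |y|^{p-l}` (`EnergyInequality.integral_v_le`).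

**Smallness.** By Hölder's inequality (`lintegral_opial_le`) the right hand side is at most
`I(s,t)^{l/p} ∫_s^t v |y|^p`, where `I(s,t)` is the integral which occurs in `K(s, t, q, v)`. It is
at most the integral over `(s,t)` of one fixed integrable function, because `K(0, r, q, v)` is
finite; thus `I(s,t) < 1` as soon as `t - s` is small, which forces `y = 0` on `[s,t]`. Starting
from `s = 0`, the vanishing propagates to all of `[0, R)` (`EnergyInequality.deriv_eq_zero`).

For the nonexistence part: once `y = 0`, the flux vanishes, hence so does its derivative, which is
then `h(τ, 0, 0)`.
-/

namespace RadialPLaplace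

open Filter Topology

/-! ### Absolutely continuous functions and their derivatives -/

/-- `f` is absolutely continuous on `[s, t]` and `f'` is its derivative almost everywhere. -/
structure HasACDeriv (f f' : ℝ → ℝ) (s t : ℝ) : Prop where
  ac : AbsolutelyContinuousOnInterval f s t
  ae_hasDerivAt : ∀ᵐ x, x ∈ Ioo s t → HasDerivAt f (f' x) x

theorem ae_mem_Ioo_of_mem_uIoc {s t : ℝ} (hst : s ≤ t) : ∀ᵐ x : ℝ, x ∈ uIoc s t → x ∈ Ioo s t := by
  filter_upwards [Measure.ae_ne volume t] with x hx hxt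
  rw [uIoc_of_le hst] at hxt
  exact ⟨hxt.1, lt_of_le_of_ne hxt.2 hx⟩

theorem absolutelyContinuousOnInterval_congr {f g : ℝ → ℝ} {s t : ℝ}
    (hf : AbsolutelyContinuousOnInterval f s t) (hfg : EqOn g f (uIcc s t)) :
    AbsolutelyContinuousOnInterval g s t := by
  refine Tendsto.congr' ?_ hf
  rw [EventuallyEq, eventually_inf_principal]
  refine Eventually.of_forall fun E hE => Finset.sum_congr rfl fun i hi => ?_
  rw [hfg (hE.1 i hi).1, hfg (hE.1 i hi).2]

theorem absolutelyContinuousOnInterval_lipschitz_comp {f ψ : ℝ → ℝ} {s t : ℝ} {S : Set ℝ}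
    {K : NNReal} (hψ : LipschitzOnWith K ψ S) (hf : AbsolutelyContinuousOnInterval f s t)
    (hfS : MapsTo f (uIcc s t) S) : AbsolutelyContinuousOnInterval (fun x => ψ (f x)) s t := by
  unfold AbsolutelyContinuousOnInterval at hf
  refine squeeze_zero' ?_ ?_ (by simpa using hf.const_mul (K : ℝ))
  · exact Eventually.of_forall fun _ => Finset.sum_nonneg fun i hi => dist_nonneg
  rw [eventually_inf_principal]
  refine Eventually.of_forall fun E hE => ?_
  rw [Finset.mul_sum]
  exact Finset.sum_le_sum fun i hi =>
    hψ.dist_le_mul _ (hfS (hE.1 i hi).1) _ (hfS (hE.1 i hi).2)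

namespace HasACDeriv

variable {f f' g g' : ℝ → ℝ} {s t : ℝ}

theorem continuousOn (hf : HasACDeriv f f' s t) (hst : s ≤ t) : ContinuousOn f (Icc s t) :=
  uIcc_of_le hst ▸ hf.ac.continuousOn

theorem mono (hf : HasACDeriv f f' s t) {c d : ℝ} (hsc : s ≤ c) (hcd : c ≤ d) (hdt : d ≤ t) :
    HasACDeriv f f' c d := by
  refine ⟨hf.ac.mono ?_, ?_⟩
  · rw [uIcc_of_le hcd, uIcc_of_le (hsc.trans (hcd.trans hdt))]
    exact Icc_subset_Icc hsc hdt
  · filter_upwards [hf.ae_hasDerivAt] with x hx hxc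
    exact hx ⟨hsc.trans_lt hxc.1, hxc.2.trans_le hdt⟩

theorem congr (hf : HasACDeriv f f' s t) (hst : s ≤ t) (hfg : EqOn g f (Icc s t)) :
    HasACDeriv g f' s t := by
  refine ⟨absolutelyContinuousOnInterval_congr hf.ac (by rwa [uIcc_of_le hst]), ?_⟩
  filter_upwards [hf.ae_hasDerivAt] with x hx hxs
  refine (hx hxs).congr_of_eventuallyEq ?_
  filter_upwards [Icc_mem_nhds hxs.1 hxs.2] with y hy using hfg hy

theorem congr_deriv (hf : HasACDeriv f f' s t) (h : ∀ᵐ x, x ∈ Ioo s t → f' x = g' x) :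
    HasACDeriv f g' s t := by
  refine ⟨hf.ac, ?_⟩
  filter_upwards [hf.ae_hasDerivAt, h] with x hx h1 hxs
  exact h1 hxs ▸ hx hxs

theorem mul (hf : HasACDeriv f f' s t) (hg : HasACDeriv g g' s t) :
    HasACDeriv (fun x => f x * g x) (fun x => f' x * g x + f x * g' x) s t := by
  refine ⟨hf.ac.fun_mul hg.ac, ?_⟩
  filter_upwards [hf.ae_hasDerivAt, hg.ae_hasDerivAt] with x h1 h2 hx
  exact (h1 hx).mul (h2 hx)

theorem ae_deriv_eq (hf : HasACDeriv f f' s t) (hst : s ≤ t) :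
    ∀ᵐ x, x ∈ uIoc s t → deriv f x = f' x := by
  filter_upwards [hf.ae_hasDerivAt, ae_mem_Ioo_of_mem_uIoc hst] with x h1 h2 hx
  exact (h1 (h2 hx)).deriv

theorem intervalIntegrable (hf : HasACDeriv f f' s t) (hst : s ≤ t) :
    IntervalIntegrable f' volume s t :=
  hf.ac.intervalIntegrable_deriv.congr_ae
    ((ae_restrict_iff' measurableSet_uIoc).2 (hf.ae_deriv_eq hst))

theorem integral_eq_sub (hf : HasACDeriv f f' s t) (hst : s ≤ t) :
    ∫ x in s..t, f' x = f t - f s := by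
  rw [← hf.ac.integral_deriv_eq_sub]
  refine intervalIntegral.integral_congr_ae ?_
  filter_upwards [hf.ae_deriv_eq hst] with x h1 hx using (h1 hx).symm

/-- Chain rule with an outer function that is Lipschitz and differentiable on the range. -/
theorem comp {ψ ψ' : ℝ → ℝ} {S : Set ℝ} {K : NNReal} (hψ : LipschitzOnWith K ψ S)
    (hψ' : ∀ z ∈ S, HasDerivAt ψ (ψ' z) z) (hf : HasACDeriv f f' s t) (hst : s ≤ t)
    (hfS : MapsTo f (Icc s t) S) :
    HasACDeriv (fun x => ψ (f x)) (fun x => ψ' (f x) * f' x) s t := by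
  refine ⟨absolutelyContinuousOnInterval_lipschitz_comp hψ hf.ac (by rwa [uIcc_of_le hst]), ?_⟩
  filter_upwards [hf.ae_hasDerivAt] with x h1 hx
  exact (hψ' _ (hfS (Ioo_subset_Icc_self hx))).comp x (h1 hx)

theorem of_contDiff {F F' : ℝ → ℝ} (hF : ContDiffOn ℝ 1 F (Icc s t)) (hst : s ≤ t)
    (hF' : ∀ x ∈ Ioo s t, HasDerivAt F (F' x) x) : HasACDeriv F F' s t :=
  ⟨ContDiffOn.absolutelyContinuousOnInterval (by rwa [uIcc_of_le hst]),
    Eventually.of_forall hF'⟩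

end HasACDeriv

/-- The primitive of an integrable function is absolutely continuous. -/
theorem hasACDeriv_primitive {g : ℝ → ℝ} {ρ : ℝ} (hρ : 0 ≤ ρ) (hg : IntegrableOn g (Ioo 0 ρ))
    (c : ℝ) : HasACDeriv (fun x => c + ∫ t in (0 : ℝ)..x, g t) g 0 ρ := by
  have hi : IntervalIntegrable g volume 0 ρ :=
    (intervalIntegrable_iff_integrableOn_Ioo_of_le hρ).2 hg
  have h0 : (0 : ℝ) ∈ uIcc 0 ρ := left_mem_uIcc
  refine ⟨?_, ?_⟩
  · have hc : AbsolutelyContinuousOnInterval (fun _ : ℝ => c) 0 ρ :=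
      (contDiff_const.contDiffOn (n := 1)).absolutelyContinuousOnInterval
    exact hc.fun_add (hi.absolutelyContinuousOnInterval_intervalIntegral h0)
  · filter_upwards [hi.ae_hasDerivAt_integral] with x hx hx0
    exact (hx (by rw [uIcc_of_le hρ]; exact Ioo_subset_Icc_self hx0) 0 h0).const_add c

/-- An absolutely continuous function vanishing on an interval has a vanishing derivative. -/
theorem HasACDeriv.ae_eq_zero {f f' : ℝ → ℝ} {s t : ℝ} (hf : HasACDeriv f f' s t)
    (h0 : ∀ x ∈ Ioo s t, f x = 0) : ∀ᵐ x, x ∈ Ioo s t → f' x = 0 := by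
  filter_upwards [hf.ae_hasDerivAt] with x h1 hx
  refine (h1 hx).unique ((hasDerivAt_const x (0 : ℝ)).congr_of_eventuallyEq ?_)
  filter_upwards [isOpen_Ioo.mem_nhds hx] with z hz using h0 z hz

/-! ### The du Bois-Reymond lemma -/

/-- A smooth function with compact support in `(0, ρ)` and zero mean has a primitive of the same
kind. -/
theorem exists_testFunction_deriv_eq {ρ : ℝ} (η : ℝ → ℝ) (hη : ContDiff ℝ (⊤ : ℕ∞) η)
    (hc : HasCompactSupport η) (hs : tsupport η ⊆ Ioo 0 ρ) (h0 : ∫ x, η x = 0) :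
    ∃ ψ : 𝓓(interval 0 ρ, ℝ), ∀ x, HasDerivAt (ψ : ℝ → ℝ) (η x) x := by
  set Ψ : ℝ → ℝ := fun x => ∫ t in (0 : ℝ)..x, η t with hΨ
  have hd : ∀ x, HasDerivAt Ψ (η x) x := fun x => hη.continuous.integral_hasStrictDerivAt 0 x
    |>.hasDerivAt
  have hcd : ContDiff ℝ (⊤ : ℕ∞) Ψ := by
    rw [contDiff_infty_iff_deriv]
    refine ⟨fun x => (hd x).differentiableAt, ?_⟩
    rwa [show deriv Ψ = η from funext fun x => (hd x).deriv]
  have hz : ∀ x, x ∉ tsupport η → η x = 0 := fun x hx => image_eq_zero_of_notMem_tsupport hx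
  rcases (tsupport η).eq_empty_or_nonempty with he | hne
  · refine ⟨⟨0, contDiff_zero_fun, .zero, by simp⟩, fun x => ?_⟩
    rw [hz x (by simp [he])]
    exact hasDerivAt_const x (0 : ℝ)
  -- the support is contained in some `[m, M] ⊆ (0, ρ)`, outside of which the primitive vanishes
  obtain ⟨m, hm, hm'⟩ := hc.isCompact.exists_isLeast hne
  obtain ⟨M, hM, hM'⟩ := hc.isCompact.exists_isGreatest hne
  have hsub : Function.support Ψ ⊆ Icc m M := by
    intro x hx
    by_contra hxm
    apply hx
    rw [mem_Icc, not_and_or, not_le, not_le] at hxm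
    have hm0 := (hs hm).1
    have hM0 := (hs hM).2
    rcases hxm with h | h
    · refine intervalIntegral.integral_zero_ae (Eventually.of_forall fun t ht => hz t fun ht' => ?_)
      rcases mem_uIoc.1 ht with h1 | h1
      · exact absurd (hm' ht') (by linarith [h1.2])
      · exact absurd (hm' ht') (by linarith [h1.2])
    · have hx0 : 0 ≤ x := by linarith [hM' hm]
      simp only [hΨ]
      rw [intervalIntegral.integral_of_le hx0, setIntegral_eq_integral_of_forall_compl_eq_zero, h0]
      intro t ht
      refine hz t fun ht' => ht ⟨(hs ht').1, (hM' ht').trans h.le⟩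
  have hts : tsupport Ψ ⊆ Icc m M := closure_minimal hsub isClosed_Icc
  refine ⟨⟨Ψ, hcd, isCompact_Icc.of_isClosed_subset (isClosed_tsupport _) hts, ?_⟩, hd⟩
  exact hts.trans (Icc_subset_Ioo (hs hm).1 (hs hM).2)

theorem testFunction_eq_zero {ρ x : ℝ} (ψ : 𝓓(interval 0 ρ, ℝ)) (hx : x ∉ Ioo 0 ρ) : ψ x = 0 :=
  image_eq_zero_of_notMem_tsupport fun h => hx (ψ.tsupport_subset h)

theorem deriv_testFunction_eq_zero {ρ x : ℝ} (ψ : 𝓓(interval 0 ρ, ℝ)) (hx : x ∉ Ioo 0 ρ) :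
    deriv ψ x = 0 :=
  image_eq_zero_of_notMem_tsupport fun h => hx (ψ.tsupport_subset (tsupport_deriv_subset h))

/-- Integration by parts against a test function on `(0, ρ)`. -/
theorem integral_mul_deriv_testFunction {g G : ℝ → ℝ} {ρ : ℝ} (hρ : 0 < ρ)
    (hG : HasACDeriv G g 0 ρ) (ψ : 𝓓(interval 0 ρ, ℝ)) :
    ∫ x in Ioo 0 ρ, G x * deriv ψ x = - ∫ x in Ioo 0 ρ, g x * ψ x := by
  have hψ : HasACDeriv ψ (deriv ψ) 0 ρ :=
    .of_contDiff (ψ.contDiff.of_le (by norm_num)).contDiffOn hρ.le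
      fun x _ => (ψ.contDiff.differentiable (by simp) x).hasDerivAt
  have h := (hG.mul hψ).integral_eq_sub hρ.le
  rw [testFunction_eq_zero ψ (x := 0) (by simp), testFunction_eq_zero ψ (x := ρ) (by simp),
    intervalIntegral.integral_add] at h
  · simp only [intervalIntegral.integral_of_le hρ.le, integral_Ioc_eq_integral_Ioo] at h
    linarith
  · exact (hG.intervalIntegrable hρ.le).mul_continuousOn ψ.continuous.continuousOn
  · refine (hψ.intervalIntegrable hρ.le).continuousOn_mul ?_
    rw [uIcc_of_le hρ.le]
    exact hG.continuousOn hρ.le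

theorem integrableOn_mul_of_hasCompactSupport {f ψ : ℝ → ℝ} {S : Set ℝ} (hf : IntegrableOn f S)
    (hψ : Continuous ψ) (hc : HasCompactSupport ψ) : IntegrableOn (fun x => f x * ψ x) S := by
  obtain ⟨C, hC⟩ := hψ.bounded_above_of_compact_support hc
  exact Integrable.mul_bdd (c := C) hf hψ.aestronglyMeasurable.restrict (Eventually.of_forall hC)

/-- An integrable function on `(0, ρ)` with an integrable weak derivative `g` agrees almost
everywhere with a primitive of `g`. -/
theorem ae_eq_primitive_of_weakDeriv {f g : ℝ → ℝ} {ρ : ℝ} (hρ : 0 < ρ)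
    (hf : IntegrableOn f (Ioo 0 ρ)) (hg : IntegrableOn g (Ioo 0 ρ))
    (hfg : ∀ ψ : 𝓓(interval 0 ρ, ℝ),
      ∫ x in Ioo 0 ρ, f x * deriv ψ x = - ∫ x in Ioo 0 ρ, g x * ψ x) :
    ∃ c : ℝ, ∀ᵐ x, x ∈ Ioo 0 ρ → f x = c + ∫ t in (0 : ℝ)..x, g t := by
  set G : ℝ → ℝ := fun x => 0 + ∫ t in (0 : ℝ)..x, g t with hGdef
  have hG : HasACDeriv G g 0 ρ := hasACDeriv_primitive hρ.le hg 0
  have hGi : IntegrableOn G (Ioo 0 ρ) :=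
    ((hG.continuousOn hρ.le).integrableOn_Icc).mono_set Ioo_subset_Icc_self
  set k : ℝ → ℝ := fun x => f x - G x with hk
  have hki : IntegrableOn k (Ioo 0 ρ) := hf.sub hGi
  have hk0 : ∀ ψ : 𝓓(interval 0 ρ, ℝ), ∫ x in Ioo 0 ρ, k x * deriv ψ x = 0 := by
    intro ψ
    have hd : Continuous (deriv ψ) := ψ.contDiff.continuous_deriv (by simp)
    have hdc : HasCompactSupport (deriv ψ) := ψ.hasCompactSupport.deriv
    have : ∀ x, k x * deriv ψ x = f x * deriv ψ x - G x * deriv ψ x := fun x => by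
      simp only [hk]; ring
    simp_rw [this]
    rw [integral_sub (integrableOn_mul_of_hasCompactSupport hf hd hdc)
      (integrableOn_mul_of_hasCompactSupport hGi hd hdc), hfg,
      integral_mul_deriv_testFunction hρ hG]
    ring
  -- a smooth bump of total mass one, used to correct the mean of an arbitrary test function
  let B : ContDiffBump (ρ / 2 : ℝ) := ⟨ρ / 8, ρ / 4, by positivity, by linarith⟩
  set χ : ℝ → ℝ := B.normed volume with hχ
  have hχs : tsupport χ ⊆ Ioo 0 ρ := by
    rw [hχ, B.tsupport_normed_eq]
    intro x hx
    rw [Metric.mem_closedBall, Real.dist_eq, abs_le] at hx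
    have h1 : B.rOut = ρ / 4 := rfl
    constructor <;> linarith [hx.1, hx.2]
  have hχd : ContDiff ℝ (⊤ : ℕ∞) χ := B.contDiff_normed
  have hχc : HasCompactSupport χ := B.hasCompactSupport_normed
  have hχ1 : ∫ x, χ x = 1 := B.integral_normed
  set c : ℝ := ∫ x in Ioo 0 ρ, k x * χ x with hcdef
  refine ⟨c, ?_⟩
  have key := isOpen_Ioo.ae_eq_zero_of_integral_contDiff_smul_eq_zero (μ := volume)
    (U := Ioo 0 ρ) (f := fun x => k x - c)
    ((hki.sub (integrableOn_const (by simp))).locallyIntegrableOn) ?_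
  · filter_upwards [key] with x hx hx0
    have := hx hx0
    simp only [hk, hGdef] at this
    linarith
  intro η hη hηc hηs
  have hηi : Integrable η := hη.continuous.integrable_of_hasCompactSupport hηc
  have hχi : Integrable χ := hχd.continuous.integrable_of_hasCompactSupport hχc
  set J : ℝ := ∫ x, η x with hJ
  have hsm : ContDiff ℝ (⊤ : ℕ∞) fun x => η x - J * χ x := hη.sub (contDiff_const.mul hχd)
  obtain ⟨ψ, hψ⟩ := exists_testFunction_deriv_eq (ρ := ρ) (fun x => η x - J * χ x) hsm
    (hηc.sub (hχc.mul_left (f := fun _ => J)))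
    ((tsupport_sub η (fun x => J * χ x)).trans (union_subset hηs
      ((tsupport_mul_subset_right (f := fun _ => J) (g := χ)).trans hχs)))
    (by rw [integral_sub hηi (hχi.const_mul J), integral_const_mul, hχ1]; simp [hJ])
  have h1 := hk0 ψ
  simp_rw [fun x => (hψ x).deriv] at h1
  have hI1 := integrableOn_mul_of_hasCompactSupport hki hη.continuous hηc
  have hI2 := integrableOn_mul_of_hasCompactSupport hki hχd.continuous hχc
  have h2 : ∫ x in Ioo 0 ρ, k x * η x = J * c := by
    have : ∀ x, k x * (η x - J * χ x) = k x * η x - J * (k x * χ x) := fun x => by ring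
    simp_rw [this] at h1
    rw [integral_sub hI1 (hI2.const_mul J), integral_const_mul] at h1
    linarith
  have h3 : ∫ x in Ioo 0 ρ, η x = J :=
    setIntegral_eq_integral_of_forall_compl_eq_zero fun x hx =>
      image_eq_zero_of_notMem_tsupport fun h => hx (hηs h)
  rw [← setIntegral_eq_integral_of_forall_compl_eq_zero (s := Ioo 0 ρ)]
  · have : ∀ x, η x • (k x - c) = k x * η x - c * η x := fun x => by simp only [smul_eq_mul]; ring
    simp_rw [this]
    rw [integral_sub hI1 (hηi.integrableOn.const_mul c), integral_const_mul, h2, h3]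
    ring
  · intro x hx
    rw [image_eq_zero_of_notMem_tsupport fun h => hx (hηs h), zero_smul]

/-! ### The energy identity -/

/-- The scalar version `|z|^{p-2} z` of `Φ_p`. -/
noncomputable def scalarPhi (p z : ℝ) : ℝ := |z| ^ (p - 2) * z

theorem scalarPhi_zero (p : ℝ) : scalarPhi p 0 = 0 := by simp [scalarPhi]

theorem abs_scalarPhi {p : ℝ} (hp : 1 < p) (z : ℝ) : |scalarPhi p z| = |z| ^ (p - 1) := by
  rcases eq_or_ne z 0 with rfl | hz
  · simp [scalarPhi, Real.zero_rpow (by linarith : p - 1 ≠ 0)]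
  · have h : 0 < |z| := abs_pos.2 hz
    rw [scalarPhi, abs_mul, abs_of_nonneg (by positivity), ← Real.rpow_add_one h.ne']
    congr 1; ring

theorem scalarPhi_mul_self {p : ℝ} (hp : 1 < p) (z : ℝ) : scalarPhi p z * z = |z| ^ p := by
  rcases eq_or_ne z 0 with rfl | hz
  · simp [scalarPhi, Real.zero_rpow (by linarith : p ≠ 0)]
  · have h : 0 < |z| := abs_pos.2 hz
    rw [scalarPhi, mul_assoc, ← abs_mul_abs_self z, ← mul_assoc, ← Real.rpow_add_one h.ne',
      ← Real.rpow_add_one h.ne']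
    congr 1; ring

theorem continuous_scalarPhi {p : ℝ} (hp : 1 < p) : Continuous (scalarPhi p) := by
  rw [continuous_iff_continuousAt]
  intro z
  rcases eq_or_ne z 0 with rfl | hz
  · rw [ContinuousAt, scalarPhi_zero]
    refine squeeze_zero_norm (a := fun z => |z| ^ (p - 1)) (fun z => (abs_scalarPhi hp z).le) ?_
    have : Continuous fun z : ℝ => |z| ^ (p - 1) :=
      continuous_abs.rpow_const fun _ => Or.inr (by linarith)
    simpa [Real.zero_rpow (by linarith : p - 1 ≠ 0)] using this.tendsto 0
  · exact (continuous_abs.continuousAt.rpow_const (Or.inl (abs_pos.2 hz).ne')).mul continuousAt_id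

theorem abs_flux_rpow {p p' a z : ℝ} (hp : 1 < p) (hp' : p' = p / (p - 1)) (ha : 0 ≤ a) :
    |a * scalarPhi p z| ^ p' = a ^ p' * |z| ^ p := by
  rw [abs_mul, abs_scalarPhi hp, abs_of_nonneg ha, Real.mul_rpow ha (by positivity),
    ← Real.rpow_mul (abs_nonneg z), hp', mul_div_cancel₀ _ (by linarith : p - 1 ≠ 0)]

/-- `Φ_{p'}` inverts `Φ_p` when `p'` is the conjugate exponent of `p`. -/
theorem flux_rpow_mul_flux {p p' a z : ℝ} (hp : 1 < p) (hp' : p' = p / (p - 1)) (ha : 0 ≤ a) :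
    |a * scalarPhi p z| ^ (p' - 2) * (a * scalarPhi p z) = a ^ (p' - 1) * z := by
  have h1 : 0 < p - 1 := by linarith
  have hp1 : p' - 1 = 1 / (p - 1) := by rw [hp']; field_simp; ring
  have hp1' : p' - 1 ≠ 0 := by rw [hp1]; positivity
  rcases ha.eq_or_lt with rfl | ha
  · simp [Real.zero_rpow hp1']
  rcases eq_or_ne z 0 with rfl | hz
  · simp [scalarPhi]
  have hz' : 0 < |z| := abs_pos.2 hz
  have e1 : a ^ (p' - 1) = a ^ (p' - 2) * a := by
    rw [← Real.rpow_add_one ha.ne']; congr 1; ring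
  have e2 : (|z| ^ (p - 1)) ^ (p' - 2) * |z| ^ (p - 2) = 1 := by
    rw [← Real.rpow_mul hz'.le, ← Real.rpow_add hz',
      show (p - 1) * (p' - 2) + (p - 2) = 0 by rw [hp']; field_simp; ring, Real.rpow_zero]
  rw [abs_mul, abs_scalarPhi hp, abs_of_pos ha, Real.mul_rpow ha.le (by positivity), e1]
  calc _ = a ^ (p' - 2) * a * z * ((|z| ^ (p - 1)) ^ (p' - 2) * |z| ^ (p - 2)) := by
        rw [scalarPhi]; ring
    _ = _ := by rw [e2, mul_one]

theorem tendsto_div_add_rpow {a c : ℝ} (ha : 0 < a) :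
    Tendsto (fun ε : ℝ => (a / (a + ε)) ^ c) (𝓝[>] 0) (𝓝 1) := by
  have h1 : Tendsto (fun ε : ℝ => a / (a + ε)) (𝓝[>] 0) (𝓝 1) := by
    have : ContinuousAt (fun ε : ℝ => a / (a + ε)) 0 := by
      refine continuousAt_const.div (by fun_prop) (by simpa using ha.ne')
    have h := this.tendsto
    simp only [add_zero, div_self ha.ne'] at h
    exact h.mono_left nhdsWithin_le_nhds
  simpa using h1.rpow_const (p := c) (Or.inl one_ne_zero)

/-- Chain rule for `|Q|^{p'} (α + ε)^{1-p'}`, where `Q = α Φ_p(y)`; unlike `y` itself, this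
regularized energy is absolutely continuous. -/
theorem hasACDeriv_regularized_energy {p p' s t ε : ℝ} (hp : 1 < p) (hp' : p' = p / (p - 1))
    (hst : s ≤ t) (hε : 0 < ε) {α a' y b : ℝ → ℝ} (hα : HasACDeriv α a' s t)
    (hα0 : ∀ x ∈ Icc s t, 0 ≤ α x)
    (hQ : HasACDeriv (fun x => α x * scalarPhi p (y x)) b s t) :
    HasACDeriv (fun x => α x * |y x| ^ p * (α x / (α x + ε)) ^ (p' - 1))
      (fun x => p' * ((α x / (α x + ε)) ^ (p' - 1) * (y x * b x))
        + (1 - p') * ((α x / (α x + ε)) ^ p' * (a' x * |y x| ^ p))) s t := by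
  have h1 : 0 < p - 1 := by linarith
  have hp1 : p' - 1 = 1 / (p - 1) := by rw [hp']; field_simp; ring
  have hp1' : 0 < p' - 1 := by rw [hp1]; positivity
  obtain ⟨C, hC⟩ := hQ.ac.exists_bound
  obtain ⟨D, hD⟩ := hα.ac.exists_bound
  rw [uIcc_of_le hst] at hC hD
  have hc1 : ContDiff ℝ 1 fun z : ℝ => |z| ^ p' := by
    simpa only [Real.norm_eq_abs] using contDiff_norm_rpow (E := ℝ) (p := p') (by linarith)
  obtain ⟨K1, hK1⟩ := hc1.contDiffOn.exists_lipschitzOnWith one_ne_zero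
    (convex_Icc (-C) C) isCompact_Icc
  have hc2 : ContDiffOn ℝ 1 (fun z : ℝ => (z + ε) ^ (1 - p')) (Icc 0 D) := by
    intro z hz
    exact ((contDiff_id.add contDiff_const).contDiffAt.rpow_const_of_ne
      (by simpa using (by linarith [hz.1] : z + ε ≠ 0))).contDiffWithinAt
  obtain ⟨K2, hK2⟩ := hc2.exists_lipschitzOnWith one_ne_zero (convex_Icc 0 D) isCompact_Icc
  have hA := HasACDeriv.comp hK1 (ψ' := fun z => p' * |z| ^ (p' - 2) * z)
    (fun z _ => hasDerivAt_abs_rpow z (by linarith)) hQ hst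
    (fun x hx => abs_le.1 (by simpa using hC x hx))
  have hB := HasACDeriv.comp hK2 (ψ' := fun z => (1 - p') * (z + ε) ^ (1 - p' - 1))
    (fun z hz => by
      have := ((hasDerivAt_id z).add_const ε).rpow_const (p := 1 - p')
        (Or.inl (by simpa using (by linarith [hz.1] : z + ε ≠ 0)))
      simpa using this) hα hst
    (fun x hx => ⟨hα0 x hx, (le_abs_self _).trans (by simpa using hD x hx)⟩)
  refine ((hA.mul hB).congr hst fun x hx => ?_).congr_deriv (Eventually.of_forall fun x hx => ?_)
  · have h0 := hα0 x hx
    have h2 : 0 < α x + ε := by linarith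
    rw [abs_flux_rpow hp hp' h0, Real.div_rpow h0 h2.le,
      show 1 - p' = -(p' - 1) by ring, Real.rpow_neg h2.le,
      show α x ^ p' = α x ^ (p' - 1) * α x by
        rw [← Real.rpow_add_one' h0 (by linarith)]; congr 1; ring]
    ring
  · have h0 := hα0 x (Ioo_subset_Icc_self hx)
    have h2 : 0 < α x + ε := by linarith
    rw [abs_flux_rpow hp hp' h0, mul_assoc p', flux_rpow_mul_flux hp hp' h0,
      Real.div_rpow h0 h2.le, Real.div_rpow h0 h2.le, show 1 - p' - 1 = -p' by ring,
      show 1 - p' = -(p' - 1) by ring, Real.rpow_neg h2.le, Real.rpow_neg h2.le]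
    ring

/-- Energy identity for a flux `α Φ_p(y)` with derivative `b`. Only the flux, and not `y`, is
assumed to be absolutely continuous, and `α` may vanish on a null set: the identity is the limit
of the one for the regularized energies. -/
theorem energy_identity {p s t : ℝ} (hp : 1 < p) (hst : s ≤ t) {α a' y b : ℝ → ℝ}
    (hα : HasACDeriv α a' s t) (hα0 : ∀ x ∈ Icc s t, 0 ≤ α x)
    (hαp : ∀ᵐ x, x ∈ Ioo s t → 0 < α x) (hy : ContinuousOn y (Icc s t))
    (hQ : HasACDeriv (fun x => α x * scalarPhi p (y x)) b s t) :
    (p - 1) / p * (α t * |y t| ^ p - α s * |y s| ^ p)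
      = ∫ x in s..t, (y x * b x - 1 / p * (a' x * |y x| ^ p)) := by
  have h1 : 0 < p - 1 := by linarith
  set p' := p / (p - 1) with hp'
  have hp1 : p' - 1 = 1 / (p - 1) := by rw [hp']; field_simp; ring
  have hp1' : 0 < p' - 1 := by rw [hp1]; positivity
  have hyp : ContinuousOn (fun x => |y x| ^ p) (Icc s t) :=
    hy.abs.rpow_const fun _ _ => Or.inr (by linarith)
  have hyb : IntervalIntegrable (fun x => y x * b x) volume s t :=
    (hQ.intervalIntegrable hst).continuousOn_mul (by rwa [uIcc_of_le hst])
  have hay : IntervalIntegrable (fun x => a' x * |y x| ^ p) volume s t :=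
    (hα.intervalIntegrable hst).mul_continuousOn (by rwa [uIcc_of_le hst])
  have hE : ∀ ε : ℝ, 0 < ε → _ := fun ε hε =>
    hasACDeriv_regularized_energy hp hp' hst hε hα hα0 hQ
  have hρ : ∀ ε : ℝ, 0 < ε → ∀ x ∈ Icc s t, ∀ c : ℝ, 0 < c →
      0 ≤ (α x / (α x + ε)) ^ c ∧ (α x / (α x + ε)) ^ c ≤ 1 := by
    intro ε hε x hx c hc
    have h0 := hα0 x hx
    exact ⟨by positivity, Real.rpow_le_one (by positivity)
      (div_le_one_of_le₀ (by linarith) (by linarith)) hc.le⟩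
  have hlim := intervalIntegral.tendsto_integral_filter_of_dominated_convergence
    (μ := volume) (a := s) (b := t) (l := 𝓝[>] (0 : ℝ))
    (F := fun ε x => p' * ((α x / (α x + ε)) ^ (p' - 1) * (y x * b x))
        + (1 - p') * ((α x / (α x + ε)) ^ p' * (a' x * |y x| ^ p)))
    (f := fun x => p' * (y x * b x) + (1 - p') * (a' x * |y x| ^ p))
    (fun x => p' * ‖y x * b x‖ + (p' - 1) * ‖a' x * |y x| ^ p‖) ?_ ?_
    ((hyb.norm.const_mul p').add (hay.norm.const_mul (p' - 1))) ?_
  rotate_left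
  · filter_upwards [self_mem_nhdsWithin] with ε hε
    exact (intervalIntegrable_iff.1 ((hE ε hε).intervalIntegrable hst)).aestronglyMeasurable
  · filter_upwards [self_mem_nhdsWithin] with ε hε
    filter_upwards [ae_mem_Ioo_of_mem_uIoc hst] with x hx hxu
    have hx' := Ioo_subset_Icc_self (hx hxu)
    obtain ⟨h2, h3⟩ := hρ ε hε x hx' (p' - 1) hp1'
    obtain ⟨h4, h5⟩ := hρ ε hε x hx' p' (by linarith)
    refine (norm_add_le _ _).trans (add_le_add ?_ ?_)
    · rw [norm_mul, norm_mul, Real.norm_of_nonneg (by linarith : 0 ≤ p'), Real.norm_of_nonneg h2]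
      have : 0 ≤ p' := by linarith
      gcongr
      exact mul_le_of_le_one_left (norm_nonneg _) h3
    · rw [norm_mul, norm_mul, Real.norm_of_nonpos (by linarith : 1 - p' ≤ 0),
        Real.norm_of_nonneg h4, neg_sub]
      gcongr
      exact mul_le_of_le_one_left (norm_nonneg _) h5
  · filter_upwards [ae_mem_Ioo_of_mem_uIoc hst, hαp] with x hx hxα hxu
    have h2 := hxα (hx hxu)
    have := (((tendsto_div_add_rpow (c := p' - 1) h2).mul_const (y x * b x)).const_mul p').add
      (((tendsto_div_add_rpow (c := p') h2).mul_const (a' x * |y x| ^ p)).const_mul (1 - p'))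
    simpa only [one_mul] using this
  have hpt : ∀ x ∈ Icc s t, Tendsto (fun ε : ℝ => α x * |y x| ^ p * (α x / (α x + ε)) ^ (p' - 1))
      (𝓝[>] 0) (𝓝 (α x * |y x| ^ p)) := by
    intro x hx
    rcases (hα0 x hx).eq_or_lt with h | h
    · simp [← h]
    · simpa only [mul_one] using (tendsto_div_add_rpow (c := p' - 1) h).const_mul (α x * |y x| ^ p)
  have hlim2 := (hpt t (right_mem_Icc.2 hst)).sub (hpt s (left_mem_Icc.2 hst))
  have heq : α t * |y t| ^ p - α s * |y s| ^ p
      = ∫ x in s..t, (p' * (y x * b x) + (1 - p') * (a' x * |y x| ^ p)) := by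
    refine tendsto_nhds_unique (hlim2.congr' ?_) hlim
    filter_upwards [self_mem_nhdsWithin] with ε hε
    exact ((hE ε hε).integral_eq_sub hst).symm
  rw [heq, ← intervalIntegral.integral_const_mul]
  refine intervalIntegral.integral_congr fun x _ => ?_
  simp only [hp']
  field_simp
  ring

/-! ### An Opial type inequality -/

/-- Two-step Hölder inequality behind Opial's inequality; the sharp constant is not needed. -/
theorem lintegral_opial_le {p l s t : ℝ} (hp : 1 < p) (hl : 0 < l) (hlp : l < p)
    {q v y u : ℝ → ℝ} (hq : AEMeasurable q (volume.restrict (Ioo s t)))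
    (hv : AEMeasurable v (volume.restrict (Ioo s t)))
    (hy : AEMeasurable y (volume.restrict (Ioo s t)))
    (hvpos : ∀ᵐ x ∂volume.restrict (Ioo s t), 0 < v x)
    (hu : ∀ x ∈ Ioo s t, ENNReal.ofReal |u x| ≤ ∫⁻ τ in Ioo s x, ENNReal.ofReal |y τ|) :
    ∫⁻ x in Ioo s t, ENNReal.ofReal (q x * |u x| ^ l * |y x| ^ (p - l))
      ≤ (∫⁻ x in Ioo s t, ENNReal.ofReal (q x) ^ (p / l) *
          ENNReal.ofReal (v x) ^ (-((p - l) / l)) *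
          (∫⁻ τ in Ioo s x, ENNReal.ofReal (v τ) ^ (-(1 / (p - 1)))) ^ (p - 1)) ^ (l / p)
        * ∫⁻ x in Ioo s t, ENNReal.ofReal (v x) * ENNReal.ofReal |y x| ^ p := by
  have hp0 : 0 < p := by linarith
  have hp1 : 0 < p - 1 := by linarith
  have hpl : 0 < p - l := by linarith
  set W : ℝ → ℝ≥0∞ := fun x => ∫⁻ τ in Ioo s x, ENNReal.ofReal (v τ) ^ (-(1 / (p - 1))) with hW
  set V : ℝ≥0∞ := ∫⁻ x in Ioo s t, ENNReal.ofReal (v x) * ENNReal.ofReal |y x| ^ p with hV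
  have hWm : Measurable W := by
    refine Monotone.measurable fun x x' hx => lintegral_mono_set (Ioo_subset_Ioo_right hx)
  have hqm : AEMeasurable (fun x => ENNReal.ofReal (q x)) (volume.restrict (Ioo s t)) :=
    hq.ennreal_ofReal
  have hvm : AEMeasurable (fun x => ENNReal.ofReal (v x)) (volume.restrict (Ioo s t)) :=
    hv.ennreal_ofReal
  have hym : AEMeasurable (fun x => ENNReal.ofReal |y x|) (volume.restrict (Ioo s t)) :=
    hy.abs.ennreal_ofReal
  -- Hölder with exponents `p / (p - 1)` and `p` bounds `u` by `W` and `V`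
  have hub : ∀ x ∈ Ioo s t, ENNReal.ofReal |u x| ≤ W x ^ ((p - 1) / p) * V ^ (1 / p) := by
    intro x hx
    have hsub : Ioo s x ⊆ Ioo s t := Ioo_subset_Ioo_right hx.2.le
    have hle : volume.restrict (Ioo s x) ≤ volume.restrict (Ioo s t) :=
      Measure.restrict_mono_set _ hsub
    refine (hu x hx).trans ?_
    have hol := ENNReal.lintegral_mul_le_Lp_mul_Lq (volume.restrict (Ioo s x))
      (p := p / (p - 1)) (q := p)
      (Real.HolderConjugate.conjExponent hp).symm
      (f := fun τ => ENNReal.ofReal (v τ) ^ (-(1 / p)))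
      (g := fun τ => (ENNReal.ofReal (v τ) * ENNReal.ofReal |y τ| ^ p) ^ (1 / p))
      ((hvm.mono_measure hle).pow_const _)
      (((hvm.mono_measure hle).mul ((hym.mono_measure hle).pow_const _)).pow_const _)
    have e1 : ∫⁻ τ in Ioo s x, ENNReal.ofReal |y τ| = ∫⁻ τ in Ioo s x,
        ((fun τ => ENNReal.ofReal (v τ) ^ (-(1 / p))) *
          fun τ => (ENNReal.ofReal (v τ) * ENNReal.ofReal |y τ| ^ p) ^ (1 / p)) τ := by
      refine lintegral_congr_ae ?_
      filter_upwards [ae_mono hle hvpos] with τ hτ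
      have h0 : ENNReal.ofReal (v τ) ≠ 0 := by simpa using hτ
      rw [Pi.mul_apply, ENNReal.mul_rpow_of_nonneg _ _ (by positivity), ← ENNReal.rpow_mul,
        mul_one_div_cancel hp0.ne', ENNReal.rpow_one, ← mul_assoc,
        ← ENNReal.rpow_add _ _ h0 ENNReal.ofReal_ne_top, neg_add_cancel, ENNReal.rpow_zero,
        one_mul]
    rw [e1]
    refine hol.trans ?_
    simp only [← ENNReal.rpow_mul, one_div_mul_cancel hp0.ne', ENNReal.rpow_one]
    rw [show -(1 / p) * (p / (p - 1)) = -(1 / (p - 1)) by field_simp,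
      show 1 / (p / (p - 1)) = (p - 1) / p by field_simp]
    gcongr
    exact lintegral_mono_set hsub
  -- Hölder with exponents `p / l` and `p / (p - l)`
  have hconj : (p / l).HolderConjugate (p / (p - l)) := by
    rw [Real.holderConjugate_iff]
    refine ⟨(one_lt_div hl).2 hlp, ?_⟩
    field_simp
    ring
  set f : ℝ → ℝ≥0∞ := fun x => ENNReal.ofReal (q x) * ENNReal.ofReal (v x) ^ (-((p - l) / p)) *
    W x ^ (l * (p - 1) / p) with hf
  set g : ℝ → ℝ≥0∞ := fun x =>
    (ENNReal.ofReal (v x) * ENNReal.ofReal |y x| ^ p) ^ ((p - l) / p) with hg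
  have hol := ENNReal.lintegral_mul_le_Lp_mul_Lq (volume.restrict (Ioo s t)) hconj
    (f := f) (g := g) ((hqm.mul (hvm.pow_const _)).mul (hWm.aemeasurable.pow_const _))
    ((hvm.mul (hym.pow_const _)).pow_const _)
  have e2 : ∀ x, f x ^ (p / l) = ENNReal.ofReal (q x) ^ (p / l) *
      ENNReal.ofReal (v x) ^ (-((p - l) / l)) * W x ^ (p - 1) := by
    intro x
    have : 0 ≤ p / l := by positivity
    simp only [hf]
    rw [ENNReal.mul_rpow_of_nonneg _ _ this, ENNReal.mul_rpow_of_nonneg _ _ this,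
      ← ENNReal.rpow_mul, ← ENNReal.rpow_mul,
      show -((p - l) / p) * (p / l) = -((p - l) / l) by field_simp,
      show l * (p - 1) / p * (p / l) = p - 1 by field_simp]
  have e3 : ∀ x, g x ^ (p / (p - l)) = ENNReal.ofReal (v x) * ENNReal.ofReal |y x| ^ p := by
    intro x
    simp only [hg]
    rw [← ENNReal.rpow_mul, show (p - l) / p * (p / (p - l)) = 1 by field_simp, ENNReal.rpow_one]
  simp_rw [e2, e3] at hol
  rw [one_div_div, one_div_div] at hol
  calc ∫⁻ x in Ioo s t, ENNReal.ofReal (q x * |u x| ^ l * |y x| ^ (p - l))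
      ≤ ∫⁻ x in Ioo s t, V ^ (l / p) * (f * g) x := by
        refine lintegral_mono_ae ?_
        filter_upwards [hvpos, ae_restrict_mem measurableSet_Ioo] with x hvx hx
        have h0 : ENNReal.ofReal (v x) ≠ 0 := by simpa using hvx
        rw [ENNReal.ofReal_mul' (by positivity), ENNReal.ofReal_mul' (by positivity),
          ← ENNReal.ofReal_rpow_of_nonneg (abs_nonneg _) hl.le,
          ← ENNReal.ofReal_rpow_of_nonneg (abs_nonneg _) hpl.le]
        have e4 : f x * g x = ENNReal.ofReal (q x) * W x ^ (l * (p - 1) / p) *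
            ENNReal.ofReal |y x| ^ (p - l) := by
          simp only [hf, hg]
          rw [ENNReal.mul_rpow_of_nonneg _ _ (by positivity), ← ENNReal.rpow_mul,
            show p * ((p - l) / p) = p - l by field_simp]
          calc _ = (ENNReal.ofReal (v x) ^ (-((p - l) / p)) * ENNReal.ofReal (v x) ^ ((p - l) / p))
                * (ENNReal.ofReal (q x) * W x ^ (l * (p - 1) / p) *
                  ENNReal.ofReal |y x| ^ (p - l)) := by ring
            _ = _ := by
              rw [← ENNReal.rpow_add _ _ h0 ENNReal.ofReal_ne_top, neg_add_cancel,
                ENNReal.rpow_zero, one_mul]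
        have e5 : ENNReal.ofReal |u x| ^ l ≤ W x ^ (l * (p - 1) / p) * V ^ (l / p) := by
          refine (ENNReal.rpow_le_rpow (hub x hx) hl.le).trans_eq ?_
          rw [ENNReal.mul_rpow_of_nonneg _ _ hl.le, ← ENNReal.rpow_mul, ← ENNReal.rpow_mul]
          congr 2 <;> ring
        rw [Pi.mul_apply, e4]
        calc _ ≤ ENNReal.ofReal (q x) * (W x ^ (l * (p - 1) / p) * V ^ (l / p)) *
              ENNReal.ofReal |y x| ^ (p - l) := by gcongr
          _ = _ := by ring
    _ = V ^ (l / p) * ∫⁻ x in Ioo s t, (f * g) x := by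
        refine lintegral_const_mul'' _ ?_
        exact ((hqm.mul (hvm.pow_const _)).mul (hWm.aemeasurable.pow_const _)).mul
          ((hvm.mul (hym.pow_const _)).pow_const _)
    _ ≤ V ^ (l / p) * ((∫⁻ x in Ioo s t, ENNReal.ofReal (q x) ^ (p / l) *
          ENNReal.ofReal (v x) ^ (-((p - l) / l)) * W x ^ (p - 1)) ^ (l / p)
          * V ^ ((p - l) / p)) := by
        gcongr
    _ = _ := by
        have e6 : V ^ (l / p) * V ^ ((p - l) / p) = V := by
          rw [← ENNReal.rpow_add_of_nonneg _ _ (by positivity) (by positivity),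
            show l / p + (p - l) / p = 1 by field_simp; ring, ENNReal.rpow_one]
        rw [mul_left_comm, e6]

/-! ### Vanishing of the profile -/

theorem CondPhi.map_zero {φ : ℝ → ℝ} (hφ : CondPhi φ) : φ 0 = 0 := by
  have := hφ.odd 0
  rw [neg_zero] at this
  linarith

theorem CondPhi.integral_nonneg {φ : ℝ → ℝ} (hφ : CondPhi φ) (z : ℝ) :
    0 ≤ ∫ t in (0 : ℝ)..z, φ t := by
  rcases le_total 0 z with hz | hz
  · rw [intervalIntegral.integral_of_le hz]
    refine setIntegral_nonneg_of_ae_restrict ?_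
    rw [EventuallyLE, ae_restrict_iff' measurableSet_Ioc]
    filter_upwards [hφ.sign] with t ht ht0
    exact (pos_of_mul_pos_right ht ht0.1.le).le
  · rw [intervalIntegral.integral_of_ge hz, neg_nonneg]
    refine setIntegral_nonpos_of_ae_restrict ?_
    rw [EventuallyLE, ae_restrict_iff' measurableSet_Ioc]
    filter_upwards [hφ.sign] with t ht ht0
    have := ht0.2
    by_contra! hc
    simp only [Pi.zero_apply] at hc
    nlinarith

/-- The differential inequality satisfied by the profile `u` of a radial solution, with `y = u'`
and flux `α Φ_p(y)`, on `(0, ρ)`. -/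
structure EnergyInequality (p l θ ρ : ℝ) (φ q v α a' b u y : ℝ → ℝ) : Prop where
  one_lt_p : 1 < p
  l_pos : 0 < l
  l_lt_p : l < p
  θ_pos : 0 < θ
  ρ_pos : 0 < ρ
  hasDerivAt : ∀ t ∈ Icc 0 ρ, HasDerivAt u (y t) t
  map_zero : u 0 = 0
  continuousOn : ContinuousOn y (Icc 0 ρ)
  deriv_zero : y 0 = 0
  condPhi : CondPhi φ
  weight : HasACDeriv α a' 0 ρ
  weight_nonneg : ∀ x ∈ Icc 0 ρ, 0 ≤ α x
  weight_pos : ∀ᵐ x, x ∈ Ioo 0 ρ → 0 < α x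
  flux : ∀ s ∈ Ioo 0 ρ, HasACDeriv (fun x => α x * scalarPhi p (y x)) b s ρ
  v_integrable : IntegrableOn v (Ioo 0 ρ)
  v_pos : ∀ᵐ x, x ∈ Ioo 0 ρ → 0 < v x
  q_integrable : IntegrableOn q (Ioo 0 ρ)
  q_nonneg : ∀ᵐ x, x ∈ Ioo 0 ρ → 0 ≤ q x
  opialK_lt_top : opialK p l 0 ρ q v < ∞
  inequality : ∀ᵐ x, x ∈ Ioo 0 ρ → y x * b x - 1 / p * (a' x * |y x| ^ p) + φ (u x) * y x
    ≤ θ * (q x * |u x| ^ l * |y x| ^ (p - l) - v x * |y x| ^ p)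

namespace EnergyInequality

variable {p l θ ρ : ℝ} {φ q v α a' b u y : ℝ → ℝ}

theorem continuousOn_u (H : EnergyInequality p l θ ρ φ q v α a' b u y) :
    ContinuousOn u (Icc 0 ρ) :=
  fun t ht => (H.hasDerivAt t ht).continuousAt.continuousWithinAt

theorem integrableOn_q_mul (H : EnergyInequality p l θ ρ φ q v α a' b u y) :
    IntegrableOn (fun x => q x * |u x| ^ l * |y x| ^ (p - l)) (Icc 0 ρ) := by
  have hl := H.l_pos
  have hlp := H.l_lt_p
  have hc : ContinuousOn (fun x => |u x| ^ l * |y x| ^ (p - l)) (Icc 0 ρ) :=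
    (H.continuousOn_u.abs.rpow_const fun _ _ => Or.inr hl.le).mul
      (H.continuousOn.abs.rpow_const fun _ _ => Or.inr (by linarith))
  simp_rw [mul_assoc]
  exact (H.q_integrable.congr_set_ae Ioo_ae_eq_Icc.symm).mul_continuousOn hc isCompact_Icc

theorem integrableOn_v_mul (H : EnergyInequality p l θ ρ φ q v α a' b u y) :
    IntegrableOn (fun x => v x * |y x| ^ p) (Icc 0 ρ) := by
  have hp := H.one_lt_p
  have hc : ContinuousOn (fun x => |y x| ^ p) (Icc 0 ρ) :=
    H.continuousOn.abs.rpow_const fun _ _ => Or.inr (by linarith)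
  exact (H.v_integrable.congr_set_ae Ioo_ae_eq_Icc.symm).mul_continuousOn hc isCompact_Icc

/-- The integrated inequality away from the origin. -/
theorem integrated (H : EnergyInequality p l θ ρ φ q v α a' b u y) {σ t : ℝ} (hσ : 0 < σ)
    (hσt : σ ≤ t) (ht : t ≤ ρ) :
    (p - 1) / p * (α t * |y t| ^ p - α σ * |y σ| ^ p)
        + ((∫ z in (0 : ℝ)..u t, φ z) - ∫ z in (0 : ℝ)..u σ, φ z)
      ≤ ∫ x in σ..t, θ * (q x * |u x| ^ l * |y x| ^ (p - l) - v x * |y x| ^ p) := by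
  rcases hσt.eq_or_lt with rfl | hσt'
  · simp
  have hp := H.one_lt_p
  have hsub : Icc σ t ⊆ Icc 0 ρ := Icc_subset_Icc hσ.le ht
  have hsubo : Ioo σ t ⊆ Ioo 0 ρ := Ioo_subset_Ioo hσ.le ht
  have hy := H.continuousOn.mono hsub
  have hα := H.weight.mono hσ.le hσt ht
  have hQ := (H.flux σ ⟨hσ, hσt'.trans_le ht⟩).mono le_rfl hσt ht
  have hφu : ContinuousOn (fun x => φ (u x) * y x) (Icc σ t) :=
    (H.condPhi.continuous.comp_continuousOn (H.continuousOn_u.mono hsub)).mul hy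
  rw [energy_identity hp hσt hα (fun x hx => H.weight_nonneg x (hsub hx))
    (by filter_upwards [H.weight_pos] with x hx hx' using hx (hsubo hx')) hy hQ]
  have hFTC : ∫ x in σ..t, φ (u x) * y x
      = (∫ z in (0 : ℝ)..u t, φ z) - ∫ z in (0 : ℝ)..u σ, φ z := by
    refine intervalIntegral.integral_eq_sub_of_hasDerivAt (f := fun x => ∫ z in (0 : ℝ)..u x, φ z)
      (fun x hx => ?_) (by
        refine ContinuousOn.intervalIntegrable ?_
        rwa [uIcc_of_le hσt])
    rw [uIcc_of_le hσt] at hx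
    exact (H.condPhi.continuous.integral_hasStrictDerivAt 0 (u x)).hasDerivAt.comp x
      (H.hasDerivAt x (hsub hx))
  have hi1 : IntervalIntegrable (fun x => y x * b x - 1 / p * (a' x * |y x| ^ p)) volume σ t := by
    refine ((hQ.intervalIntegrable hσt).continuousOn_mul (by rwa [uIcc_of_le hσt])).sub
      (((hα.intervalIntegrable hσt).mul_continuousOn ?_).const_mul _)
    rw [uIcc_of_le hσt]
    exact hy.abs.rpow_const fun _ _ => Or.inr (by linarith)
  have hi2 : IntervalIntegrable (fun x => φ (u x) * y x) volume σ t :=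
    ContinuousOn.intervalIntegrable (by rwa [uIcc_of_le hσt])
  rw [← hFTC, ← intervalIntegral.integral_add hi1 hi2]
  refine intervalIntegral.integral_mono_ae_restrict hσt (hi1.add hi2) ?_ ?_
  · rw [intervalIntegrable_iff_integrableOn_Icc_of_le hσt]
    exact ((H.integrableOn_q_mul.sub H.integrableOn_v_mul).mono_set hsub).const_mul θ
  · rw [← Measure.restrict_congr_set Ioo_ae_eq_Icc, EventuallyLE,
      ae_restrict_iff' measurableSet_Ioo]
    filter_upwards [H.inequality] with x hx hx'
    exact hx (hsubo hx')

theorem u_eq_integral (H : EnergyInequality p l θ ρ φ q v α a' b u y) {s t : ℝ} (hs : 0 ≤ s)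
    (hst : s ≤ t) (ht : t ≤ ρ) : ∫ x in s..t, y x = u t - u s := by
  have hsub : Icc s t ⊆ Icc 0 ρ := Icc_subset_Icc hs ht
  refine intervalIntegral.integral_eq_sub_of_hasDerivAt (fun x hx => ?_)
    (ContinuousOn.intervalIntegrable ?_)
  · rw [uIcc_of_le hst] at hx
    exact H.hasDerivAt x (hsub hx)
  · rw [uIcc_of_le hst]
    exact H.continuousOn.mono hsub

theorem u_eq_zero_of_deriv_eq_zero (H : EnergyInequality p l θ ρ φ q v α a' b u y) {t : ℝ}
    (ht : t ∈ Icc 0 ρ) (hy : ∀ x ∈ Icc 0 t, y x = 0) : u t = 0 := by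
  have h1 := H.u_eq_integral le_rfl ht.1 ht.2
  rw [H.map_zero, sub_zero] at h1
  rw [← h1]
  refine intervalIntegral.integral_zero_ae (Eventually.of_forall fun x hx => ?_)
  rw [uIoc_of_le ht.1] at hx
  exact hy x ⟨hx.1.le, hx.2⟩

/-- The integrated inequality from a point up to which the profile vanishes; at the origin it is
the limit of the previous one. -/
theorem integral_v_le (H : EnergyInequality p l θ ρ φ q v α a' b u y) {s t : ℝ} (hs : 0 ≤ s)
    (hst : s < t) (ht : t ≤ ρ) (hus : u s = 0) (hys : y s = 0) :
    ∫ x in Ioo s t, v x * |y x| ^ p ≤ ∫ x in Ioo s t, q x * |u x| ^ l * |y x| ^ (p - l) := by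
  have hp := H.one_lt_p
  have hsub : Icc s t ⊆ Icc 0 ρ := Icc_subset_Icc hs ht
  set D : ℝ → ℝ := fun x => q x * |u x| ^ l * |y x| ^ (p - l) - v x * |y x| ^ p with hD
  have hDi : IntegrableOn (fun x => θ * D x) (Icc s t) :=
    ((H.integrableOn_q_mul.sub H.integrableOn_v_mul).mono_set hsub).const_mul θ
  have hsm : s ∈ Icc s t := left_mem_Icc.2 hst.le
  have hcont1 : ContinuousOn (fun σ => (p - 1) / p * (α t * |y t| ^ p - α σ * |y σ| ^ p)
        + ((∫ z in (0 : ℝ)..u t, φ z) - ∫ z in (0 : ℝ)..u σ, φ z)) (Icc s t) := by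
    have h1 : ContinuousOn (fun σ => |y σ| ^ p) (Icc s t) :=
      (H.continuousOn.mono hsub).abs.rpow_const fun _ _ => Or.inr (by linarith)
    have h2 : ContinuousOn α (Icc s t) := (H.weight.continuousOn H.ρ_pos.le).mono hsub
    have h3 : Continuous fun z => ∫ w in (0 : ℝ)..z, φ w :=
      intervalIntegral.continuous_primitive (fun a b => H.condPhi.continuous.intervalIntegrable a b)
        0
    have h4 := h3.comp_continuousOn (H.continuousOn_u.mono hsub)
    exact (continuousOn_const.mul (continuousOn_const.sub (h2.mul h1))).add
      (continuousOn_const.sub h4)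
  have hcont2 : ContinuousOn (fun σ => ∫ x in σ..t, θ * D x) (Icc s t) := by
    have h1 := intervalIntegral.continuousOn_primitive_interval (μ := volume) (a := s) (b := t)
      (f := fun x => θ * D x) (by rwa [uIcc_of_le hst.le])
    rw [uIcc_of_le hst.le] at h1
    refine (continuousOn_const (c := ∫ x in s..t, θ * D x) |>.sub h1).congr fun σ hσ => ?_
    have hi1 : IntervalIntegrable (fun x => θ * D x) volume s t :=
      (intervalIntegrable_iff_integrableOn_Icc_of_le hst.le).2 hDi
    rw [Pi.sub_apply, eq_sub_iff_add_eq, add_comm]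
    refine intervalIntegral.integral_add_adjacent_intervals (hi1.mono_set ?_) (hi1.mono_set ?_)
    · rw [uIcc_of_le hst.le, uIcc_of_le hσ.1]; exact Icc_subset_Icc_right hσ.2
    · rw [uIcc_of_le hst.le, uIcc_of_le hσ.2]; exact Icc_subset_Icc_left hσ.1
  have hle : (p - 1) / p * (α t * |y t| ^ p - α s * |y s| ^ p)
        + ((∫ z in (0 : ℝ)..u t, φ z) - ∫ z in (0 : ℝ)..u s, φ z) ≤ ∫ x in s..t, θ * D x := by
    have hnb : (𝓝[Ioo s t] s).NeBot := by
      rw [← mem_closure_iff_nhdsWithin_neBot, closure_Ioo hst.ne]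
      exact hsm
    have hm : 𝓝[Ioo s t] s ≤ 𝓝[Icc s t] s := nhdsWithin_mono _ Ioo_subset_Icc_self
    refine le_of_tendsto_of_tendsto ((hcont1 s hsm).mono_left hm) ((hcont2 s hsm).mono_left hm) ?_
    filter_upwards [self_mem_nhdsWithin] with σ hσ
    exact H.integrated (hs.trans_lt hσ.1) hσ.2.le ht
  rw [hys, hus, abs_zero, Real.zero_rpow (by linarith), mul_zero, sub_zero,
    intervalIntegral.integral_same, sub_zero, intervalIntegral.integral_const_mul,
    intervalIntegral.integral_of_le hst.le, integral_Ioc_eq_integral_Ioo] at hle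
  have h1 : 0 ≤ (p - 1) / p * (α t * |y t| ^ p) := by
    have := H.weight_nonneg t (hsub (right_mem_Icc.2 hst.le))
    have : 0 ≤ p - 1 := by linarith
    positivity
  have h2 := H.condPhi.integral_nonneg (u t)
  have h3 : 0 ≤ ∫ x in Ioo s t, D x := nonneg_of_mul_nonneg_right (by linarith) H.θ_pos
  have hio : Ioo s t ⊆ Icc 0 ρ := Ioo_subset_Icc_self.trans hsub
  rw [hD, integral_sub (H.integrableOn_q_mul.mono_set hio)
    (H.integrableOn_v_mul.mono_set hio)] at h3
  linarith

/-- The integrand of `K(0, ρ, q, v)` is integrable, so its integral over `(s, t)` is smaller than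
one when `t` is close to `s`. -/
theorem exists_small_opial (H : EnergyInequality p l θ ρ φ q v α a' b u y) :
    ∃ δ > 0, ∀ s t : ℝ, 0 ≤ s → t ≤ ρ → t - s < δ →
      ∫⁻ x in Ioo s t, ENNReal.ofReal (q x) ^ (p / l) *
          ENNReal.ofReal (v x) ^ (-((p - l) / l)) *
          (∫⁻ τ in Ioo s x, ENNReal.ofReal (v τ) ^ (-(1 / (p - 1)))) ^ (p - 1) < 1 := by
  have hp := H.one_lt_p
  have hl := H.l_pos
  have hlp := H.l_lt_p
  have hfin : ∫⁻ x in Ioo 0 ρ, ENNReal.ofReal (q x) ^ (p / l) *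
          ENNReal.ofReal (v x) ^ (-((p - l) / l)) *
          (∫⁻ τ in Ioo 0 x, ENNReal.ofReal (v τ) ^ (-(1 / (p - 1)))) ^ (p - 1) ≠ ∞ := by
    intro htop
    have hK := H.opialK_lt_top
    have hpl : 0 < (p - l) / p := div_pos (by linarith) (by linarith)
    have hc : ENNReal.ofReal (((p - l) / p) ^ ((p - l) / p)) ≠ 0 := by
      rw [ne_eq, ENNReal.ofReal_eq_zero, not_le]
      exact Real.rpow_pos_of_pos hpl _
    rw [opialK, htop, ENNReal.top_rpow_of_pos (div_pos hl (by linarith)),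
      ENNReal.mul_top hc] at hK
    exact lt_irrefl _ hK
  obtain ⟨δ, hδ, hδ'⟩ := exists_pos_setLIntegral_lt_of_measure_lt hfin one_ne_zero
  obtain ⟨δ', hδ1, hδ2⟩ := ENNReal.lt_iff_exists_nnreal_btwn.1 hδ
  refine ⟨δ', by exact_mod_cast hδ1, fun s t hs ht hst => ?_⟩
  have hsub : Ioo s t ⊆ Ioo 0 ρ := Ioo_subset_Ioo hs ht
  have hm := hδ' (Ioo s t) (by
    refine (Measure.restrict_le_self _).trans_lt ?_
    rw [Real.volume_Ioo]
    refine lt_of_le_of_lt ?_ hδ2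
    rw [← ENNReal.ofReal_coe_nnreal]
    exact ENNReal.ofReal_le_ofReal hst.le)
  rw [Measure.restrict_restrict measurableSet_Ioo, inter_eq_left.2 hsub] at hm
  refine lt_of_le_of_lt (lintegral_mono fun x => ?_) hm
  have : 0 ≤ p - 1 := by linarith
  gcongr

theorem eq_zero_of_small (H : EnergyInequality p l θ ρ φ q v α a' b u y) {s t : ℝ} (hs : 0 ≤ s)
    (hst : s < t) (ht : t ≤ ρ) (hus : u s = 0) (hys : y s = 0)
    (hsmall : ∫⁻ x in Ioo s t, ENNReal.ofReal (q x) ^ (p / l) *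
          ENNReal.ofReal (v x) ^ (-((p - l) / l)) *
          (∫⁻ τ in Ioo s x, ENNReal.ofReal (v τ) ^ (-(1 / (p - 1)))) ^ (p - 1) < 1) :
    ∀ x ∈ Icc s t, y x = 0 := by
  have hp := H.one_lt_p
  have hl := H.l_pos
  have hlp := H.l_lt_p
  have hsub : Icc s t ⊆ Icc 0 ρ := Icc_subset_Icc hs ht
  have hsubo : Ioo s t ⊆ Ioo 0 ρ := Ioo_subset_Ioo hs ht
  have hio : Ioo s t ⊆ Icc 0 ρ := Ioo_subset_Icc_self.trans hsub
  have hy := H.continuousOn.mono hsub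
  have hvpos : ∀ᵐ x ∂volume.restrict (Ioo s t), 0 < v x := by
    rw [ae_restrict_iff' measurableSet_Ioo]
    filter_upwards [H.v_pos] with x hx hx' using hx (hsubo hx')
  have hq0 : ∀ᵐ x ∂volume.restrict (Ioo s t), 0 ≤ q x := by
    rw [ae_restrict_iff' measurableSet_Ioo]
    filter_upwards [H.q_nonneg] with x hx hx' using hx (hsubo hx')
  have hym : AEMeasurable y (volume.restrict (Ioo s t)) :=
    (hy.mono Ioo_subset_Icc_self).aemeasurable measurableSet_Ioo
  have hop := lintegral_opial_le hp hl hlp (H.q_integrable.mono_set hsubo).aemeasurable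
    (H.v_integrable.mono_set hsubo).aemeasurable hym hvpos (u := u) ?_
  · set I := ∫⁻ x in Ioo s t, ENNReal.ofReal (q x) ^ (p / l) *
          ENNReal.ofReal (v x) ^ (-((p - l) / l)) *
          (∫⁻ τ in Ioo s x, ENNReal.ofReal (v τ) ^ (-(1 / (p - 1)))) ^ (p - 1)
    have hVeq : ∫⁻ x in Ioo s t, ENNReal.ofReal (v x) * ENNReal.ofReal |y x| ^ p
        = ENNReal.ofReal (∫ x in Ioo s t, v x * |y x| ^ p) := by
      rw [ofReal_integral_eq_lintegral_ofReal (H.integrableOn_v_mul.mono_set hio)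
        (by filter_upwards [hvpos] with x hx; exact mul_nonneg hx.le (by positivity))]
      refine lintegral_congr fun x => ?_
      rw [ENNReal.ofReal_mul' (by positivity),
        ENNReal.ofReal_rpow_of_nonneg (abs_nonneg _) (by linarith)]
    have hUeq : ∫⁻ x in Ioo s t, ENNReal.ofReal (q x * |u x| ^ l * |y x| ^ (p - l))
        = ENNReal.ofReal (∫ x in Ioo s t, q x * |u x| ^ l * |y x| ^ (p - l)) := by
      rw [ofReal_integral_eq_lintegral_ofReal (H.integrableOn_q_mul.mono_set hio)
        (by filter_upwards [hq0] with x hx; positivity)]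
    rw [hUeq, hVeq] at hop
    have hle := (ENNReal.ofReal_le_ofReal (H.integral_v_le hs hst ht hus hys)).trans hop
    have hI : I ^ (l / p) < 1 := ENNReal.rpow_lt_one hsmall (div_pos hl (by linarith))
    -- `V ≤ I ^ (l / p) V` with `I < 1` and `V < ∞` leaves only `V = 0`
    have hV0 : ENNReal.ofReal (∫ x in Ioo s t, v x * |y x| ^ p) = 0 := by
      by_contra hne
      have := ENNReal.mul_lt_mul_left hne ENNReal.ofReal_ne_top hI
      rw [one_mul] at this
      exact absurd hle (not_le.2 this)
    have hm : AEMeasurable (fun x => ENNReal.ofReal (v x) * ENNReal.ofReal |y x| ^ p)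
        (volume.restrict (Ioo s t)) :=
      (H.v_integrable.mono_set hsubo).aemeasurable.ennreal_ofReal.mul
        (hym.abs.ennreal_ofReal.pow_const p)
    rw [← hVeq, lintegral_eq_zero_iff' hm] at hV0
    have hy0 : y =ᵐ[volume.restrict (Icc s t)] fun _ => 0 := by
      rw [← Measure.restrict_congr_set Ioo_ae_eq_Icc]
      filter_upwards [hV0, hvpos] with x hx hvx
      rcases mul_eq_zero.1 hx with h | h
      · exact absurd hvx (not_lt.2 (ENNReal.ofReal_eq_zero.1 h))
      · rw [ENNReal.rpow_eq_zero_iff_of_pos (by linarith), ENNReal.ofReal_eq_zero] at h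
        exact abs_nonpos_iff.1 h
    exact Measure.eqOn_Icc_of_ae_eq volume hst.ne hy0 hy continuousOn_const
  · intro x hx
    have hux : u x = ∫ τ in s..x, y τ := by
      rw [H.u_eq_integral hs hx.1.le (hx.2.le.trans ht), hus, sub_zero]
    have hyx : IntegrableOn (fun τ => |y τ|) (Ioo s x) :=
      ((hy.abs.integrableOn_Icc).mono_set
        (Ioo_subset_Icc_self.trans (Icc_subset_Icc_right hx.2.le)))
    rw [← ofReal_integral_eq_lintegral_ofReal hyx (Eventually.of_forall fun _ => abs_nonneg _), hux,
      ← integral_Ioc_eq_integral_Ioo, ← intervalIntegral.integral_of_le hx.1.le]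
    exact ENNReal.ofReal_le_ofReal (intervalIntegral.abs_integral_le_integral_abs hx.1.le)

/-- The profile is constant: the set of `t` such that `y` vanishes on `[0, t]` is closed, and
`eq_zero_of_small` allows one to go beyond each of its points. -/
theorem deriv_eq_zero (H : EnergyInequality p l θ ρ φ q v α a' b u y) :
    ∀ x ∈ Icc 0 ρ, y x = 0 := by
  obtain ⟨δ, hδ, hδ'⟩ := H.exists_small_opial
  have hρ := H.ρ_pos
  set Z : Set ℝ := {t | ∀ x ∈ Icc 0 ρ, x ≤ t → y x = 0} with hZ
  have hsubZ : Icc 0 ρ ⊆ Z := by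
    refine IsClosed.Icc_subset_of_forall_exists_gt ?_ ?_ ?_
    · rw [← closure_subset_iff_isClosed]
      intro t ht
      have htI : t ∈ Icc 0 ρ := isClosed_Icc.closure_subset_iff.2 inter_subset_right ht
      refine ⟨fun x hx hxt => ?_, htI⟩
      -- points left of `t` are left of a point of `Z`; at `t` itself continuity is used
      have hlt : ∀ z ∈ Icc 0 ρ, z < t → y z = 0 := by
        intro z hz hzt
        obtain ⟨t', ht', hzt'⟩ := mem_closure_iff.1 ht (Ioi z) isOpen_Ioi hzt
        exact hzt'.1 z hz (le_of_lt ht')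
      rcases hxt.lt_or_eq with h | rfl
      · exact hlt x hx h
      rcases hx.1.eq_or_lt with rfl | h0
      · exact H.deriv_zero
      have hnb : (𝓝[Ioo 0 x] x).NeBot := by
        rw [← mem_closure_iff_nhdsWithin_neBot, closure_Ioo h0.ne]
        exact right_mem_Icc.2 h0.le
      have h1 : Tendsto y (𝓝[Ioo 0 x] x) (𝓝 (y x)) :=
        (H.continuousOn x hx).mono_left (nhdsWithin_mono _ fun z hz =>
          ⟨hz.1.le, hz.2.le.trans hx.2⟩)
      refine tendsto_nhds_unique (h1.congr' ?_) tendsto_const_nhds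
      filter_upwards [self_mem_nhdsWithin] with z hz
      exact hlt z ⟨hz.1.le, hz.2.le.trans hx.2⟩ hz.2
    · intro x hx hx0
      rw [le_antisymm hx0 hx.1]
      exact H.deriv_zero
    · rintro s ⟨hsZ, hs⟩ r hr
      have hus : u s = 0 :=
        H.u_eq_zero_of_deriv_eq_zero ⟨hs.1, hs.2.le⟩ fun x hx =>
          hsZ x ⟨hx.1, hx.2.trans hs.2.le⟩ hx.2
      have hys : y s = 0 := hsZ s ⟨hs.1, hs.2.le⟩ le_rfl
      set t := min (min r ρ) (s + δ / 2) with ht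
      have hst : s < t := lt_min (lt_min hr hs.2) (by linarith)
      have htρ : t ≤ ρ := (min_le_left _ _).trans (min_le_right _ _)
      have htr : t ≤ r := (min_le_left _ _).trans (min_le_left _ _)
      have htδ : t - s < δ := by linarith [min_le_right (min r ρ) (s + δ / 2)]
      refine ⟨t, fun x hx hxt => ?_, hst, htr⟩
      rcases le_total x s with h | h
      · exact hsZ x hx h
      · exact H.eq_zero_of_small hs.1 hst htρ hus hys (hδ' s t hs.1 htρ htδ) x ⟨h, hxt⟩
  exact fun x hx => hsubZ hx x hx le_rfl

theorem u_eq_zero (H : EnergyInequality p l θ ρ φ q v α a' b u y) :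
    ∀ t ∈ Icc 0 ρ, u t = 0 :=
  fun _ ht => H.u_eq_zero_of_deriv_eq_zero ht fun x hx =>
    H.deriv_eq_zero x ⟨hx.1, hx.2.trans ht.2⟩

end EnergyInequality

/-! ### Radial functions and radial test functions -/

section Radial

variable {n : ℕ}

theorem gradient_radial {f : EuclideanSpace ℝ (Fin n) → ℝ} {u : ℝ → ℝ} {u' : ℝ}
    {x : EuclideanSpace ℝ (Fin n)} (hx : x ≠ 0) (hf : f =ᶠ[𝓝 x] fun z => u ‖z‖)
    (hu : HasDerivAt u u' ‖x‖) : ∇ f x = (u' * ‖x‖⁻¹) • x := by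
  have hnx : ‖x‖ ≠ 0 := norm_ne_zero_iff.2 hx
  have h1 : HasFDerivAt (fun z : EuclideanSpace ℝ (Fin n) => ‖z‖) (‖x‖⁻¹ • innerSL ℝ x) x := by
    have h := (hasStrictFDerivAt_norm_sq x).hasFDerivAt.sqrt (pow_ne_zero 2 hnx)
    simp only [Real.sqrt_sq (norm_nonneg _)] at h
    refine h.congr_fderiv (ContinuousLinearMap.ext fun z => ?_)
    simp
    field_simp
  have h2 := (hu.comp_hasFDerivAt x h1).congr_of_eventuallyEq hf
  refine HasGradientAt.gradient ?_
  rw [hasGradientAt_iff_hasFDerivAt]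
  refine h2.congr_fderiv (ContinuousLinearMap.ext fun z => ?_)
  simp
  ring

/-- The radial test function `x ↦ η(|x|)` attached to a test function `η` on `(0, ρ)`. -/
noncomputable def radialTestFunction {ρ R : ℝ} (hρ : ρ ≤ R) (η : 𝓓(interval 0 ρ, ℝ)) :
    𝓓(oball n R, ℝ) := by
  have hts : tsupport (fun x : EuclideanSpace ℝ (Fin n) => η ‖x‖) ⊆
      (fun x => ‖x‖) ⁻¹' tsupport η :=
    closure_minimal (fun x hx => subset_tsupport _ hx)
      ((isClosed_tsupport _).preimage continuous_norm)
  have hball : tsupport (fun x : EuclideanSpace ℝ (Fin n) => η ‖x‖) ⊆ Metric.ball 0 R :=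
    fun x hx => by
      have := η.tsupport_subset (hts hx)
      rw [mem_ball_zero_iff]
      exact this.2.trans_le hρ
  refine ⟨fun x => η ‖x‖, ?_, ?_, hball⟩
  · rw [contDiff_iff_contDiffAt]
    intro x
    by_cases hx : x = 0
    · have h0 : (0 : ℝ) ∉ tsupport η := fun h => lt_irrefl _ (η.tsupport_subset h).1
      refine (contDiffAt_const (c := (0 : ℝ))).congr_of_eventuallyEq ?_
      have : ∀ᶠ τ in 𝓝 ‖x‖, η τ = 0 := by
        rw [hx, norm_zero]
        exact notMem_tsupport_iff_eventuallyEq.1 h0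
      exact continuous_norm.continuousAt.eventually this
    · exact η.contDiff.contDiffAt.comp x (contDiffAt_norm ℝ hx)
  · exact (isCompact_closedBall (0 : EuclideanSpace ℝ (Fin n)) R).of_isClosed_subset
      (isClosed_tsupport _) (hball.trans Metric.ball_subset_closedBall)

theorem radialTestFunction_apply {ρ R : ℝ} (hρ : ρ ≤ R) (η : 𝓓(interval 0 ρ, ℝ))
    (x : EuclideanSpace ℝ (Fin n)) : radialTestFunction hρ η x = η ‖x‖ := rfl

theorem gradient_radialTestFunction {ρ R : ℝ} (hρ : ρ ≤ R) (η : 𝓓(interval 0 ρ, ℝ))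
    {x : EuclideanSpace ℝ (Fin n)} (hx : x ≠ 0) :
    ∇ (radialTestFunction hρ η : EuclideanSpace ℝ (Fin n) → ℝ) x = (deriv η ‖x‖ * ‖x‖⁻¹) • x :=
  gradient_radial hx (Eventually.of_forall fun _ => rfl)
    (η.contDiff.differentiable (by simp) _).hasDerivAt

/-- The surface area of the unit sphere, as it occurs in polar coordinates. -/
noncomputable def sphereArea (n : ℕ) : ℝ :=
  n * (volume : Measure (EuclideanSpace ℝ (Fin n))).real (Metric.ball 0 1)

theorem sphereArea_pos (hn : 0 < n) : 0 < sphereArea n := by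
  have : Nonempty (Fin n) := ⟨⟨0, hn⟩⟩
  refine mul_pos (by exact_mod_cast hn) (ENNReal.toReal_pos ?_ measure_ball_lt_top.ne)
  exact (Metric.measure_ball_pos _ _ one_pos).ne'

theorem integral_ball_radial (hn : 0 < n) (R : ℝ) (f : ℝ → ℝ) :
    ∫ x in Metric.ball (0 : EuclideanSpace ℝ (Fin n)) R, f ‖x‖
      = sphereArea n * ∫ τ in Ioo 0 R, τ ^ (n - 1) * f τ := by
  have : Nonempty (Fin n) := ⟨⟨0, hn⟩⟩
  rw [← integral_indicator measurableSet_ball]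
  have h1 : ∀ x : EuclideanSpace ℝ (Fin n), (Metric.ball 0 R).indicator (fun x => f ‖x‖) x
      = (Iio R).indicator f ‖x‖ := fun x => by simp [indicator]
  simp_rw [h1]
  rw [integral_fun_norm_addHaar volume ((Iio R).indicator f)]
  have h2 : ∀ τ : ℝ, τ ^ (n - 1) • (Iio R).indicator f τ
      = (Iio R).indicator (fun τ => τ ^ (n - 1) * f τ) τ := fun τ => by
    by_cases h : τ < R <;> simp [h]
  simp only [finrank_euclideanSpace, Fintype.card_fin, h2]
  rw [setIntegral_indicator measurableSet_Iio, Ioi_inter_Iio, sphereArea, nsmul_eq_mul, smul_eq_mul,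
    mul_assoc]

theorem ae_radial (hn : 0 < n) {R : ℝ} {P : ℝ → Prop} (hP : ∀ᵐ τ, τ ∈ Ioo 0 R → P τ) :
    ∀ᵐ x : EuclideanSpace ℝ (Fin n), x ∈ Metric.ball 0 R → x ≠ 0 → P ‖x‖ := by
  have : Nonempty (Fin n) := ⟨⟨0, hn⟩⟩
  obtain ⟨N, hN, hNm, hN0⟩ := exists_measurable_superset_of_null (ae_iff.1 hP)
  have hz : ∀ᵐ τ ∂volume.restrict (Ioi 0), τ ^ (n - 1) • N.indicator (fun _ => (1 : ℝ)) τ = 0 := by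
    refine ae_restrict_of_ae ?_
    filter_upwards [measure_eq_zero_iff_ae_notMem.1 hN0] with τ hτ
    simp [hτ]
  have hint : Integrable
      (fun x : EuclideanSpace ℝ (Fin n) => N.indicator (fun _ => (1 : ℝ)) ‖x‖) := by
    rw [integrable_fun_norm_addHaar volume (f := N.indicator fun _ => (1 : ℝ))]
    simp only [finrank_euclideanSpace, Fintype.card_fin]
    exact (integrable_zero ℝ ℝ _).congr (by filter_upwards [hz] with τ hτ using hτ.symm)
  have h0 : ∫ x : EuclideanSpace ℝ (Fin n), N.indicator (fun _ => (1 : ℝ)) ‖x‖ = 0 := by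
    rw [integral_fun_norm_addHaar volume (N.indicator fun _ => (1 : ℝ))]
    simp only [finrank_euclideanSpace, Fintype.card_fin]
    rw [integral_eq_zero_of_ae hz]
    simp
  rw [integral_eq_zero_iff_of_nonneg (fun x => indicator_nonneg (fun _ _ => zero_le_one) _) hint]
    at h0
  filter_upwards [h0] with x hx hxR hx0
  by_contra hnP
  have : ‖x‖ ∈ N := hN fun h => hnP (h ⟨norm_pos_iff.2 hx0, by simpa using hxR⟩)
  simp [this] at hx

theorem ae_ne_zero (hn : 0 < n) : ∀ᵐ x : EuclideanSpace ℝ (Fin n), x ≠ 0 := by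
  have : Nonempty (Fin n) := ⟨⟨0, hn⟩⟩
  exact Measure.ae_ne volume 0

theorem integrableOn_of_radial (hn : 0 < n) {R ρ : ℝ} (hρ : ρ < R)
    {f : EuclideanSpace ℝ (Fin n) → ℝ} {g : ℝ → ℝ} (hf : LocallyIntegrableOn f (Metric.ball 0 R))
    (hfg : ∀ᵐ x, x ∈ Metric.ball 0 R → f x = g ‖x‖) :
    IntegrableOn (fun τ => τ ^ (n - 1) * g τ) (Ioo 0 ρ) := by
  have : Nonempty (Fin n) := ⟨⟨0, hn⟩⟩
  have hsub : Metric.closedBall (0 : EuclideanSpace ℝ (Fin n)) ρ ⊆ Metric.ball 0 R :=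
    Metric.closedBall_subset_ball hρ
  have h1 : IntegrableOn f (Metric.ball 0 ρ) :=
    (hf.integrableOn_compact_subset hsub (isCompact_closedBall _ _)).mono_set
      Metric.ball_subset_closedBall
  have h2 : IntegrableOn (fun x : EuclideanSpace ℝ (Fin n) => g ‖x‖) (Metric.ball 0 ρ) := by
    refine h1.congr_fun_ae ?_
    rw [EventuallyEq, ae_restrict_iff' measurableSet_ball]
    filter_upwards [hfg] with x hx hxρ
    exact hx (Metric.ball_subset_ball hρ.le hxρ)
  have h3 := (integrableOn_fun_norm_addHaar volume (f := g) (r := ρ)).1 h2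
  simpa only [finrank_euclideanSpace, Fintype.card_fin, smul_eq_mul] using h3

/-- Integrals over the ball of radial functions supported in `(0, ρ)`, in polar coordinates. -/
theorem integral_Ioo_eq_of_radial (hn : 0 < n) {ρ R : ℝ} (hρ : ρ ≤ R) {F G : ℝ → ℝ}
    (hF : ∀ τ, τ ∉ Ioo 0 ρ → F τ = 0) (hG : ∀ τ, τ ∉ Ioo 0 ρ → G τ = 0)
    (h : ∫ x in Metric.ball (0 : EuclideanSpace ℝ (Fin n)) R, F ‖x‖
      = ∫ x in Metric.ball (0 : EuclideanSpace ℝ (Fin n)) R, G ‖x‖) :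
    ∫ τ in Ioo 0 ρ, τ ^ (n - 1) * F τ = ∫ τ in Ioo 0 ρ, τ ^ (n - 1) * G τ := by
  rw [integral_ball_radial hn R F, integral_ball_radial hn R G] at h
  have h1 := mul_left_cancel₀ (sphereArea_pos hn).ne' h
  have hsub : Ioo 0 ρ ⊆ Ioo 0 R := Ioo_subset_Ioo_right hρ
  rwa [setIntegral_eq_of_subset_of_forall_sdiff_eq_zero measurableSet_Ioo hsub
      (fun τ hτ => by rw [hF τ hτ.2, mul_zero]),
    setIntegral_eq_of_subset_of_forall_sdiff_eq_zero measurableSet_Ioo hsub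
      (fun τ hτ => by rw [hG τ hτ.2, mul_zero])] at h1

/-- If `τ^{n-1} F` has the weak derivative `τ^{n-1} g` on `(0, ρ)`, where `F` is continuous up to
the endpoints, then `F' = g - (n-1) F/τ` in the absolutely continuous sense away from `0`. -/
theorem hasACDeriv_of_weak_radial (hn : 2 ≤ n) {ρ : ℝ} (hρ : 0 < ρ) {F F₀ g : ℝ → ℝ}
    (hF : ContinuousOn F (Icc 0 ρ)) (hF₀ : ∀ᵐ τ, τ ∈ Ioo 0 ρ → F₀ τ = F τ)
    (hg : IntegrableOn (fun τ => τ ^ (n - 1) * g τ) (Ioo 0 ρ))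
    (h : ∀ η : 𝓓(interval 0 ρ, ℝ), ∫ τ in Ioo 0 ρ, τ ^ (n - 1) * F₀ τ * deriv η τ
      = - ∫ τ in Ioo 0 ρ, τ ^ (n - 1) * g τ * η τ) {s : ℝ} (hs : s ∈ Ioo 0 ρ) :
    HasACDeriv F (fun τ => g τ - ((n : ℝ) - 1) * (F τ / τ)) s ρ := by
  obtain ⟨m, rfl⟩ : ∃ m, n = m + 2 := ⟨n - 2, by omega⟩
  simp only [show m + 2 - 1 = m + 1 by omega] at *
  have hcont : ContinuousOn (fun τ => τ ^ (m + 1) * F τ) (Icc 0 ρ) :=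
    (continuous_pow _).continuousOn.mul hF
  obtain ⟨c, hc⟩ := ae_eq_primitive_of_weakDeriv (f := fun τ => τ ^ (m + 1) * F τ) hρ
    (hcont.integrableOn_Icc.mono_set Ioo_subset_Icc_self) hg (fun η => by
      rw [← h η]
      refine setIntegral_congr_ae measurableSet_Ioo ?_
      filter_upwards [hF₀] with τ hτ hτ'
      rw [hτ hτ'])
  have hprim := hasACDeriv_primitive hρ.le hg c
  have heq : EqOn (fun τ => τ ^ (m + 1) * F τ)
      (fun τ => c + ∫ t in (0 : ℝ)..τ, t ^ (m + 1) * g t) (Icc 0 ρ) := by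
    refine Measure.eqOn_Icc_of_ae_eq volume hρ.ne ?_ hcont (hprim.continuousOn hρ.le)
    rw [← Measure.restrict_congr_set Ioo_ae_eq_Icc, EventuallyEq,
      ae_restrict_iff' measurableSet_Ioo]
    exact hc
  have h1 := (hprim.congr hρ.le heq).mono hs.1.le hs.2.le le_rfl
  have h2 : HasACDeriv (fun τ : ℝ => (τ ^ (m + 1))⁻¹)
      (fun τ => -((m + 1 : ℕ) * τ ^ m) / (τ ^ (m + 1)) ^ 2) s ρ := by
    refine HasACDeriv.of_contDiff ?_ hs.2.le fun τ hτ => ?_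
    · exact (contDiff_id.pow (m + 1)).contDiffOn.inv fun τ hτ =>
        pow_ne_zero _ (hs.1.trans_le hτ.1).ne'
    · have := (hasDerivAt_pow (m + 1) τ).inv (pow_ne_zero _ (hs.1.trans hτ.1).ne')
      exact this.congr_deriv (by push_cast; simp)
  refine ((h1.mul h2).congr hs.2.le fun τ hτ => ?_).congr_deriv
    (Eventually.of_forall fun τ hτ => ?_)
  · have : τ ≠ 0 := (hs.1.trans_le hτ.1).ne'
    field_simp
  · have : τ ≠ 0 := (hs.1.trans hτ.1).ne'
    push_cast
    field_simp
    ring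

end Radial

/-! ### The profile of a radial solution -/

/-- `w(x) = u(|x|)` on `B(0, R)`, where `u` is of class `C¹` with derivative `y`, and both vanish at
the origin. -/
structure IsProfile {n : ℕ} (R : ℝ) (w : EuclideanSpace ℝ (Fin n) → ℝ) (u y : ℝ → ℝ) : Prop where
  hasDerivAt : ∀ t ∈ Ioo (-R) R, HasDerivAt u (y t) t
  continuousOn : ContinuousOn y (Ioo (-R) R)
  map_zero : u 0 = 0
  deriv_zero : y 0 = 0
  eq_radial : ∀ x ∈ Metric.ball (0 : EuclideanSpace ℝ (Fin n)) R, w x = u ‖x‖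

theorem IsAdmissible.exists_profile {n : ℕ} (hn : 0 < n) {p R : ℝ} (hR : 0 < R)
    {w : EuclideanSpace ℝ (Fin n) → ℝ} (hw : IsAdmissible p R w) :
    ∃ u y : ℝ → ℝ, IsProfile R w u y := by
  obtain ⟨u₀, hu₀⟩ := hw.radial
  set e : EuclideanSpace ℝ (Fin n) := EuclideanSpace.single ⟨0, hn⟩ 1 with he
  have hne : ‖e‖ = 1 := by simp [he]
  have hnorm : ∀ t : ℝ, ‖t • e‖ = |t| := fun t => by rw [norm_smul, hne, mul_one, Real.norm_eq_abs]
  set u : ℝ → ℝ := fun t => w (t • e) with hu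
  have hmaps : MapsTo (fun t : ℝ => t • e) (Ioo (-R) R) (Metric.ball 0 R) := fun t ht => by
    rw [mem_ball_zero_iff, hnorm, abs_lt]
    exact ht
  have hcd : ContDiffOn ℝ 1 u (Ioo (-R) R) :=
    hw.contDiffOn.comp (contDiff_id.smul contDiff_const).contDiffOn hmaps
  have h0 : (0 : ℝ) ∈ Ioo (-R) R := ⟨by linarith, hR⟩
  have hd : ∀ t ∈ Ioo (-R) R, HasDerivAt u (deriv u t) t := fun t ht =>
    ((hcd.contDiffAt (isOpen_Ioo.mem_nhds ht)).differentiableAt one_ne_zero).hasDerivAt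
  have hev : ∀ t ∈ Ioo (-R) R, u (-t) = u t := fun t ht => by
    have ht' : -t ∈ Ioo (-R) R := ⟨by linarith [ht.2], by linarith [ht.1]⟩
    simp only [hu]
    rw [hu₀ _ (hmaps ht), hu₀ _ (hmaps ht'), hnorm, hnorm, abs_neg]
  refine ⟨u, deriv u, hd, hcd.continuousOn_deriv_of_isOpen isOpen_Ioo le_rfl, ?_, ?_, ?_⟩
  · simp [hu, hw.map_zero]
  · -- `u` is even
    have h1 : HasDerivAt (fun t => u (-t)) (-(deriv u 0)) 0 := by
      have h := hd 0 h0
      rw [← neg_zero] at h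
      exact (h.comp (0 : ℝ) (hasDerivAt_neg (0 : ℝ))).congr_deriv (by simp)
    have h2 : HasDerivAt (fun t => u (-t)) (deriv u 0) 0 :=
      (hd 0 h0).congr_of_eventuallyEq
        (by filter_upwards [isOpen_Ioo.mem_nhds h0] with t ht using hev t ht)
    linarith [h1.unique h2]
  · intro x hx
    have hx' : ‖x‖ ∈ Ioo (-R) R :=
      ⟨by linarith [norm_nonneg x], by simpa using hx⟩
    simp only [hu]
    rw [hu₀ _ (hmaps hx'), hu₀ x hx, hnorm, abs_norm]

namespace IsProfile

variable {n : ℕ} {R : ℝ} {w : EuclideanSpace ℝ (Fin n) → ℝ} {u y : ℝ → ℝ}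

theorem norm_mem {x : EuclideanSpace ℝ (Fin n)} (hx : x ∈ Metric.ball 0 R) :
    ‖x‖ ∈ Ioo (-R) R := by
  rw [mem_ball_zero_iff] at hx
  exact ⟨by linarith [norm_nonneg x], hx⟩

theorem gradient_eq (hu : IsProfile R w u y) {x : EuclideanSpace ℝ (Fin n)}
    (hx : x ∈ Metric.ball 0 R) (hx0 : x ≠ 0) : ∇ w x = (y ‖x‖ * ‖x‖⁻¹) • x := by
  refine gradient_radial hx0 ?_ (hu.hasDerivAt _ (norm_mem hx))
  filter_upwards [Metric.isOpen_ball.mem_nhds hx] with z hz using hu.eq_radial z hz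

theorem hTerm_eq (hu : IsProfile R w u y) (h : ℝ → ℝ → ℝ → ℝ) {x : EuclideanSpace ℝ (Fin n)}
    (hx : x ∈ Metric.ball 0 R) (hx0 : x ≠ 0) : hTerm h w x = h ‖x‖ (u ‖x‖) (y ‖x‖) := by
  have hnx : ‖x‖ ≠ 0 := norm_ne_zero_iff.2 hx0
  rw [hTerm, hu.gradient_eq hx hx0, hu.eq_radial x hx, real_inner_smul_left, real_inner_smul_right,
    real_inner_self_eq_norm_sq]
  congr 1
  field_simp

theorem Phi_gradient_eq (hu : IsProfile R w u y) (p : ℝ) {x : EuclideanSpace ℝ (Fin n)}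
    (hx : x ∈ Metric.ball 0 R) (hx0 : x ≠ 0) :
    Phi p (∇ w x) = (scalarPhi p (y ‖x‖) * ‖x‖⁻¹) • x := by
  have hnx : ‖x‖ ≠ 0 := norm_ne_zero_iff.2 hx0
  have h1 : ‖∇ w x‖ = |y ‖x‖| := by
    rw [hu.gradient_eq hx hx0, norm_smul, norm_mul, norm_inv, norm_norm, mul_assoc,
      inv_mul_cancel₀ hnx, mul_one, Real.norm_eq_abs]
  rw [Phi, h1, hu.gradient_eq hx hx0, smul_smul, scalarPhi, mul_assoc]

/-- The flux tested with a radial test function. -/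
theorem inner_Phi_gradient (hu : IsProfile R w u y) (p : ℝ) {ρ : ℝ} (hρ : ρ ≤ R)
    (η : 𝓓(interval 0 ρ, ℝ)) {x : EuclideanSpace ℝ (Fin n)}
    (hx : x ∈ Metric.ball 0 R) (hx0 : x ≠ 0) :
    inner ℝ (Phi p (∇ w x)) (∇ (radialTestFunction hρ η : EuclideanSpace ℝ (Fin n) → ℝ) x)
      = scalarPhi p (y ‖x‖) * deriv η ‖x‖ := by
  have hnx : ‖x‖ ≠ 0 := norm_ne_zero_iff.2 hx0
  rw [hu.Phi_gradient_eq p hx hx0, gradient_radialTestFunction hρ η hx0, real_inner_smul_left,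
    real_inner_smul_right, real_inner_self_eq_norm_sq]
  field_simp

end IsProfile

/-! ### The equation satisfied by the profile -/

theorem ae_of_ae_restrict_Ioo {R ρ : ℝ} (hρ : ρ ≤ R) {P : ℝ → Prop}
    (h : ∀ᵐ τ ∂volume.restrict (Ioo 0 R), P τ) : ∀ᵐ τ, τ ∈ Ioo 0 ρ → P τ := by
  rw [ae_restrict_iff' measurableSet_Ioo] at h
  filter_upwards [h] with τ hτ hτ' using hτ ⟨hτ'.1, hτ'.2.trans_le hρ⟩

/-- The absolutely continuous representative of the weight. -/
theorem CondWeight.exists_representative {p R ρ : ℝ} {a a' v : ℝ → ℝ} (h : CondWeight p R a a' v)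
    (hρ : ρ ∈ Ioo 0 R) :
    ∃ α : ℝ → ℝ, HasACDeriv α a' 0 ρ ∧ (∀ᵐ τ, τ ∈ Ioo 0 ρ → a τ = α τ) ∧
      (∀ τ ∈ Icc 0 ρ, 0 ≤ α τ) := by
  obtain ⟨h1, h2, h3⟩ := h.memW11Loc ρ hρ.1 hρ.2
  obtain ⟨c, hc⟩ := ae_eq_primitive_of_weakDeriv hρ.1 h1 h2 fun ψ => by
    have := h3.integral_eq ψ
    simp only [fderiv_apply_one_eq_deriv] at this
    exact this
  have hα := hasACDeriv_primitive hρ.1.le h2 c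
  refine ⟨_, hα, hc, fun τ hτ => ?_⟩
  have hcont := hα.continuousOn hρ.1.le
  have habs := Measure.eqOn_Icc_of_ae_eq volume hρ.1.ne
    (g := fun τ => |c + ∫ t in (0 : ℝ)..τ, a' t|)
    ?_ hcont hcont.abs hτ
  · simp only at habs
    rw [habs]
    exact abs_nonneg _
  · rw [← Measure.restrict_congr_set Ioo_ae_eq_Icc, EventuallyEq,
      ae_restrict_iff' measurableSet_Ioo]
    filter_upwards [hc, ae_of_ae_restrict_Ioo hρ.2.le h.pos] with x hx hx' hxρ
    rw [← hx hxρ, abs_of_pos (hx' hxρ)]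

/-- The derivative of the flux `α Φ_p(u')` prescribed by the equation for the profile. -/
noncomputable def fluxDeriv (p : ℝ) (φ a' v : ℝ → ℝ) (h : ℝ → ℝ → ℝ → ℝ) (u y : ℝ → ℝ)
    (τ : ℝ) : ℝ :=
  h τ (u τ) (y τ) - φ (u τ) - (v τ - 1 / p * a' τ) * scalarPhi p (y τ)

section

variable {n : ℕ} {p l R θ ρ : ℝ} {φ a a' q v u y α : ℝ → ℝ} {h : ℝ → ℝ → ℝ → ℝ}
  {w : EuclideanSpace ℝ (Fin n) → ℝ}

theorem IsProfile.continuousOn_Icc (hu : IsProfile R w u y) (hρ : ρ ∈ Ioo 0 R) :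
    ContinuousOn y (Icc 0 ρ) :=
  hu.continuousOn.mono fun t ht => ⟨by linarith [ht.1, hρ.1, hρ.2], ht.2.trans_lt hρ.2⟩

theorem IsProfile.continuousOn_ball (hu : IsProfile R w u y) (hφ : Continuous φ) :
    ContinuousOn (fun x => φ (w x)) (Metric.ball 0 R) := by
  refine hφ.comp_continuousOn ((ContinuousOn.comp (t := Ioo (-R) R) (g := u) (f := norm)
    (fun t ht => (hu.hasDerivAt t ht).continuousAt.continuousWithinAt)
    continuous_norm.continuousOn fun x hx => IsProfile.norm_mem hx).congr fun x hx => ?_)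
  exact hu.eq_radial x hx

theorem integrableOn_ball_mul_testFunction {f : EuclideanSpace ℝ (Fin n) → ℝ}
    (hf : LocallyIntegrableOn f (Metric.ball 0 R)) (ψ : 𝓓(oball n R, ℝ)) :
    IntegrableOn (fun x => f x * ψ x) (Metric.ball 0 R) := by
  obtain ⟨C, hC⟩ := ψ.continuous.bounded_above_of_compact_support ψ.hasCompactSupport
  have h1 : IntegrableOn f (tsupport ψ) :=
    hf.integrableOn_compact_subset ψ.tsupport_subset ψ.hasCompactSupport
  have h2 : IntegrableOn (fun x => f x * ψ x) (tsupport ψ) :=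
    Integrable.mul_bdd (c := C) h1 ψ.continuous.aestronglyMeasurable.restrict
      (Eventually.of_forall hC)
  exact h2.of_forall_sdiff_eq_zero measurableSet_ball fun x hx => by
    rw [image_eq_zero_of_notMem_tsupport hx.2, mul_zero]

/-- The flux of the profile for the equation in divergence form. -/
theorem hasACDeriv_flux_of_solvesDiv (hn : 2 ≤ n) (hp : 1 < p) (hu : IsProfile R w u y)
    (hρ : ρ ∈ Ioo 0 R) (hφ : Continuous φ) (hsol : SolvesDiv p R φ a h w)
    (hα : ContinuousOn α (Icc 0 ρ)) (haα : ∀ᵐ τ, τ ∈ Ioo 0 ρ → a τ = α τ)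
    {s : ℝ} (hs : s ∈ Ioo 0 ρ) :
    HasACDeriv (fun τ => α τ * scalarPhi p (y τ)) (fluxDeriv p φ a' (dA n p a a') h u y) s ρ := by
  obtain ⟨-, hh, heq⟩ := hsol
  have hn0 : 0 < n := by omega
  have hρR := hρ.2.le
  have hhI := integrableOn_of_radial (g := fun τ => h τ (u τ) (y τ)) hn0 hρ.2 hh
    (by filter_upwards [ae_ne_zero hn0] with x hx hxR using hu.hTerm_eq h hxR hx)
  have hφI := integrableOn_of_radial (g := fun τ => φ (u τ)) hn0 hρ.2
    ((hu.continuousOn_ball hφ).locallyIntegrableOn measurableSet_ball)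
    (Eventually.of_forall fun x hx => by rw [hu.eq_radial x hx])
  have hF : ContinuousOn (fun τ => α τ * scalarPhi p (y τ)) (Icc 0 ρ) :=
    hα.mul ((continuous_scalarPhi hp).comp_continuousOn (hu.continuousOn_Icc hρ))
  have hFI : IntegrableOn (fun τ => τ ^ (n - 1) * (a τ * scalarPhi p (y τ))) (Ioo 0 ρ) := by
    have h1 : IntegrableOn (fun τ => τ ^ (n - 1) * (α τ * scalarPhi p (y τ))) (Ioo 0 ρ) :=
      (((continuous_pow (n - 1)).continuousOn.mul hF).integrableOn_Icc).mono_set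
        Ioo_subset_Icc_self
    refine h1.congr_fun_ae ?_
    rw [EventuallyEq, ae_restrict_iff' measurableSet_Ioo]
    filter_upwards [haα] with τ hτ hτ'
    rw [hτ hτ']
  have hmain := hasACDeriv_of_weak_radial (F₀ := fun τ => a τ * scalarPhi p (y τ))
    (g := fun τ => h τ (u τ) (y τ) - φ (u τ)) hn hρ.1 hF
    (by filter_upwards [haα] with τ hτ hτ'; rw [hτ hτ'])
    (by simp only [mul_sub]; exact hhI.sub hφI) (fun η => ?_) hs
  · refine hmain.congr_deriv ?_
    filter_upwards [haα] with τ hτ hτ'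
    have : a τ = α τ := hτ ⟨hs.1.trans hτ'.1, hτ'.2⟩
    simp only [fluxDeriv, dA]
    rw [this]
    ring
  · have h1 := heq (radialTestFunction hρR η)
    have h2 := integral_Ioo_eq_of_radial hn0 hρR
      (F := fun τ => a τ * scalarPhi p (y τ) * deriv η τ + h τ (u τ) (y τ) * η τ)
      (G := fun τ => φ (u τ) * η τ)
      (fun τ hτ => by
        rw [testFunction_eq_zero η hτ, deriv_testFunction_eq_zero η hτ, mul_zero, mul_zero,
          add_zero])
      (fun τ hτ => by rw [testFunction_eq_zero η hτ, mul_zero]) (by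
        rw [← setIntegral_congr_ae (μ := volume) measurableSet_ball (f := fun x => φ (w x) *
            radialTestFunction hρR η x) (g := fun x => φ (u ‖x‖) * η ‖x‖)
            (Eventually.of_forall fun x hx => by
              rw [radialTestFunction_apply, hu.eq_radial x hx]), ← h1]
        refine setIntegral_congr_ae measurableSet_ball ?_
        filter_upwards [ae_ne_zero hn0] with x hx hxR
        rw [real_inner_smul_left, hu.inner_Phi_gradient p hρR η hxR hx, hu.hTerm_eq h hxR hx,
          radialTestFunction_apply, mul_assoc])
    have hηd : Continuous (deriv η) := η.contDiff.continuous_deriv (by simp)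
    have i1 := integrableOn_mul_of_hasCompactSupport hFI hηd η.hasCompactSupport.deriv
    have i2 := integrableOn_mul_of_hasCompactSupport hhI η.continuous η.hasCompactSupport
    have i3 := integrableOn_mul_of_hasCompactSupport hφI η.continuous η.hasCompactSupport
    have e1 : ∀ τ, τ ^ (n - 1) * (a τ * scalarPhi p (y τ) * deriv η τ + h τ (u τ) (y τ) * η τ)
        = τ ^ (n - 1) * (a τ * scalarPhi p (y τ)) * deriv η τ
          + τ ^ (n - 1) * h τ (u τ) (y τ) * η τ := fun τ => by ring
    have e2 : ∀ τ, τ ^ (n - 1) * (h τ (u τ) (y τ) - φ (u τ)) * η τ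
        = τ ^ (n - 1) * h τ (u τ) (y τ) * η τ - τ ^ (n - 1) * φ (u τ) * η τ := fun τ => by ring
    simp_rw [e1, ← mul_assoc (_ ^ (n - 1)) (φ _)] at h2
    rw [integral_add i1 i2] at h2
    simp_rw [e2]
    rw [integral_sub i2 i3]
    linarith

/-- In the non-divergence equation the weak divergence is a radial function, because `a` is
positive almost everywhere. -/
theorem ae_eq_radial_of_solvesNonDiv (hn : 0 < n) (hu : IsProfile R w u y)
    (hφ : Continuous φ) (hapos : ∀ᵐ τ ∂volume.restrict (Ioo 0 R), 0 < a τ)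
    {D : EuclideanSpace ℝ (Fin n) → ℝ}
    (hD : LocallyIntegrableOn (fun x => a ‖x‖ * D x) (Metric.ball 0 R))
    (hh : LocallyIntegrableOn (hTerm h w) (Metric.ball 0 R))
    (heq : ∀ ψ : 𝓓(oball n R, ℝ),
      ∫ x in Metric.ball 0 R, (-(a ‖x‖ * D x) + hTerm h w x) * ψ x
        = ∫ x in Metric.ball 0 R, φ (w x) * ψ x) :
    ∀ᵐ x, x ∈ Metric.ball 0 R →
      D x = (h ‖x‖ (u ‖x‖) (y ‖x‖) - φ (u ‖x‖)) / a ‖x‖ := by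
  have hφI : LocallyIntegrableOn (fun x => φ (w x)) (Metric.ball 0 R) :=
    (hu.continuousOn_ball hφ).locallyIntegrableOn measurableSet_ball
  have hL : LocallyIntegrableOn (fun x => -(a ‖x‖ * D x) + hTerm h w x) (Metric.ball 0 R) :=
    hD.neg.add hh
  have key := Metric.isOpen_ball.ae_eq_zero_of_integral_contDiff_smul_eq_zero (μ := volume)
    (U := Metric.ball (0 : EuclideanSpace ℝ (Fin n)) R) (hL.sub hφI) fun g hg hgc hgs => by
      have h1 := heq ⟨g, hg, hgc, hgs⟩
      have i1 := integrableOn_ball_mul_testFunction hL ⟨g, hg, hgc, hgs⟩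
      have i2 := integrableOn_ball_mul_testFunction hφI ⟨g, hg, hgc, hgs⟩
      rw [← sub_eq_zero, ← integral_sub i1 i2] at h1
      rw [← setIntegral_eq_integral_of_forall_compl_eq_zero (s := Metric.ball 0 R)]
      · rw [← h1]
        refine integral_congr_ae (Eventually.of_forall fun x => ?_)
        change g x * (-(a ‖x‖ * D x) + hTerm h w x - φ (w x))
          = (-(a ‖x‖ * D x) + hTerm h w x) * g x - φ (w x) * g x
        ring
      · intro x hx
        rw [image_eq_zero_of_notMem_tsupport fun h => hx (hgs h), zero_smul]
  filter_upwards [key, ae_ne_zero hn, ae_radial hn (ae_of_ae_restrict_Ioo le_rfl hapos)]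
    with x hx hx0 hxa hxR
  have h1 := hx hxR
  have h2 := hxa hxR hx0
  simp only [Pi.sub_apply, hu.hTerm_eq h hxR hx0, hu.eq_radial x hxR] at h1
  rw [eq_div_iff h2.ne']
  linarith

/-- The flux of the profile for the equation in non-divergence form. -/
theorem hasACDeriv_flux_of_solvesNonDiv (hn : 2 ≤ n) (hp : 1 < p) (hu : IsProfile R w u y)
    (hρ : ρ ∈ Ioo 0 R) (hφ : Continuous φ) (hsol : SolvesNonDiv p R φ a h w)
    (hapos : ∀ᵐ τ ∂volume.restrict (Ioo 0 R), 0 < a τ)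
    (hα : HasACDeriv α a' 0 ρ) (haα : ∀ᵐ τ, τ ∈ Ioo 0 ρ → a τ = α τ)
    {s : ℝ} (hs : s ∈ Ioo 0 ρ) :
    HasACDeriv (fun τ => α τ * scalarPhi p (y τ)) (fluxDeriv p φ a' (deltaA n p a a') h u y)
      s ρ := by
  obtain ⟨D, hdiv, haD, hh, heq⟩ := hsol
  have hn0 : 0 < n := by omega
  have hρR := hρ.2.le
  have hDr := ae_eq_radial_of_solvesNonDiv hn0 hu hφ hapos haD hh heq
  have hgI := integrableOn_of_radial (g := fun τ => (h τ (u τ) (y τ) - φ (u τ)) / a τ) hn0 hρ.2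
    hdiv.locallyIntegrableOn_div hDr
  have hmain := hasACDeriv_of_weak_radial (F := fun τ => scalarPhi p (y τ)) hn hρ.1
    ((continuous_scalarPhi hp).comp_continuousOn (hu.continuousOn_Icc hρ))
    (Eventually.of_forall fun τ _ => rfl) hgI (fun η => ?_) hs
  · refine ((hα.mono hs.1.le hs.2.le le_rfl).mul hmain).congr_deriv ?_
    filter_upwards [haα, ae_of_ae_restrict_Ioo hρR hapos] with τ hτ hτp hτ'
    have hτρ : τ ∈ Ioo 0 ρ := ⟨hs.1.trans hτ'.1, hτ'.2⟩
    have h1 := hτ hτρ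
    have h2 : α τ ≠ 0 := by rw [← h1]; exact (hτp hτρ).ne'
    have h3 : τ ≠ 0 := hτρ.1.ne'
    simp only [fluxDeriv, deltaA]
    rw [h1]
    field_simp
    ring
  · have h1 := hdiv.integral_eq (radialTestFunction hρR η)
    have h2 := integral_Ioo_eq_of_radial hn0 hρR
      (F := fun τ => scalarPhi p (y τ) * deriv η τ)
      (G := fun τ => -((h τ (u τ) (y τ) - φ (u τ)) / a τ * η τ))
      (fun τ hτ => by rw [deriv_testFunction_eq_zero η hτ, mul_zero])
      (fun τ hτ => by rw [testFunction_eq_zero η hτ, mul_zero, neg_zero]) (by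
        rw [integral_neg, ← setIntegral_congr_ae (μ := volume) measurableSet_ball
            (f := fun x => D x * radialTestFunction hρR η x)
            (g := fun x => (h ‖x‖ (u ‖x‖) (y ‖x‖) - φ (u ‖x‖)) / a ‖x‖ * η ‖x‖)
            (by filter_upwards [hDr] with x hx hxR; rw [radialTestFunction_apply, hx hxR])]
        refine Eq.trans ?_ h1
        refine setIntegral_congr_ae measurableSet_ball ?_
        filter_upwards [ae_ne_zero hn0] with x hx hxR
        rw [hu.inner_Phi_gradient p hρR η hxR hx])
    simp only [mul_neg, integral_neg, ← mul_assoc] at h2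
    simpa only [mul_assoc] using h2

/-- The structural assumptions together with the equation for the flux give the differential
inequality for the profile. -/
theorem energyInequality_of_flux (hu : IsProfile R w u y) (hρ : ρ ∈ Ioo 0 R) {N : ℝ}
    (hN : CondN N p l R θ φ a a' q v h) (hα : HasACDeriv α a' 0 ρ)
    (haα : ∀ᵐ τ, τ ∈ Ioo 0 ρ → a τ = α τ) (hα0 : ∀ τ ∈ Icc 0 ρ, 0 ≤ α τ)
    (hflux : ∀ s ∈ Ioo 0 ρ, HasACDeriv (fun τ => α τ * scalarPhi p (y τ))
      (fluxDeriv p φ a' v h u y) s ρ) :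
    EnergyInequality p l θ ρ φ q v α a' (fluxDeriv p φ a' v h u y) u y where
  one_lt_p := hN.numbers.one_lt_p
  l_pos := hN.numbers.l_pos
  l_lt_p := hN.numbers.l_lt_p
  θ_pos := hN.growth.θ_pos
  ρ_pos := hρ.1
  hasDerivAt t ht := hu.hasDerivAt t ⟨by linarith [ht.1, hρ.1, hρ.2], ht.2.trans_lt hρ.2⟩
  map_zero := hu.map_zero
  continuousOn := hu.continuousOn_Icc hρ
  deriv_zero := hu.deriv_zero
  condPhi := hN.phi
  weight := hα
  weight_nonneg := hα0
  weight_pos := by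
    filter_upwards [haα, ae_of_ae_restrict_Ioo hρ.2.le hN.weight.pos] with τ h1 h2 hτ
    exact h1 hτ ▸ h2 hτ
  flux := hflux
  v_integrable := hN.weight.v_memL1Loc ρ hρ.1 hρ.2
  v_pos := ae_of_ae_restrict_Ioo hρ.2.le hN.weight.v_pos
  q_integrable := hN.growth.q_memL1Loc ρ hρ.1 hρ.2
  q_nonneg := ae_of_ae_restrict_Ioo hρ.2.le hN.growth.q_nonneg
  opialK_lt_top := hN.opialK_lt_top ρ hρ.1 hρ.2
  inequality := by
    filter_upwards [ae_of_ae_restrict_Ioo hρ.2.le hN.growth.bound] with τ h1 hτ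
    have h2 := h1 hτ (u τ) (y τ)
    have h3 := scalarPhi_mul_self hN.numbers.one_lt_p (y τ)
    simp only [fluxDeriv]
    have h4 : y τ * (h τ (u τ) (y τ) - φ (u τ) - (v τ - 1 / p * a' τ) * scalarPhi p (y τ))
        = h τ (u τ) (y τ) * y τ - φ (u τ) * y τ - (v τ - 1 / p * a' τ) * |y τ| ^ p := by
      rw [← h3]; ring
    rw [h4]
    linarith

/-- The profile of a solution satisfies the differential inequality on each `(0, ρ)` with `ρ < R`,
for one and the same derivative of the flux. -/
theorem exists_energyInequality (hn : 2 ≤ n) (hu : IsProfile R w u y)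
    (hsol : CondNnd n p l R θ φ a a' q h ∧ SolvesNonDiv p R φ a h w ∨
      CondNd n p l R θ φ a a' q h ∧ SolvesDiv p R φ a h w) :
    ∃ v : ℝ → ℝ, ∀ ρ ∈ Ioo 0 R, ∃ α : ℝ → ℝ,
      EnergyInequality p l θ ρ φ q v α a' (fluxDeriv p φ a' v h u y) u y := by
  rcases hsol with ⟨hN, hsol⟩ | ⟨hN, hsol⟩
  · refine ⟨deltaA n p a a', fun ρ hρ => ?_⟩
    obtain ⟨α, hα, haα, hα0⟩ := hN.weight.exists_representative hρ
    exact ⟨α, energyInequality_of_flux hu hρ hN hα haα hα0 fun s hs =>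
      hasACDeriv_flux_of_solvesNonDiv hn hN.numbers.one_lt_p hu hρ hN.phi.continuous hsol
        hN.weight.pos hα haα hs⟩
  · refine ⟨dA n p a a', fun ρ hρ => ?_⟩
    obtain ⟨α, hα, haα, hα0⟩ := hN.weight.exists_representative hρ
    exact ⟨α, energyInequality_of_flux hu hρ hN hα haα hα0 fun s hs =>
      hasACDeriv_flux_of_solvesDiv hn hN.numbers.one_lt_p hu hρ hN.phi.continuous hsol
        (hα.continuousOn hρ.1.le) haα hs⟩

end

/-- Where the profile vanishes the flux does too, hence so does its derivative `h(τ, 0, 0)`. -/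
theorem EnergyInequality.ae_h_eq_zero {p l θ ρ : ℝ} {φ q v α a' u y : ℝ → ℝ} {h : ℝ → ℝ → ℝ → ℝ}
    (H : EnergyInequality p l θ ρ φ q v α a' (fluxDeriv p φ a' v h u y) u y) {s : ℝ}
    (hs : s ∈ Ioo 0 ρ) : ∀ᵐ τ, τ ∈ Ioo s ρ → h τ 0 0 = 0 := by
  have hy := H.deriv_eq_zero
  have hu : ∀ t ∈ Icc 0 ρ, u t = 0 := H.u_eq_zero
  filter_upwards [(H.flux s hs).ae_eq_zero fun x hx => by
    rw [hy x ⟨hs.1.le.trans hx.1.le, hx.2.le⟩, scalarPhi_zero, mul_zero]] with τ hτ hτs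
  have hτI : τ ∈ Icc 0 ρ := ⟨hs.1.le.trans hτs.1.le, hτs.2.le⟩
  simpa [fluxDeriv, hy τ hτI, hu τ hτI, scalarPhi_zero, H.condPhi.map_zero] using hτ hτs

end RadialPLaplace

theorem mainTheorem2 (n : ℕ) (hn : 2 ≤ n) (p l R θ : ℝ) (φ a a' q : ℝ → ℝ)
    (h : ℝ → ℝ → ℝ → ℝ) :
    (∀ w : EuclideanSpace ℝ (Fin n) → ℝ,
      RadialPLaplace.IsAdmissible p R w →
      (RadialPLaplace.CondNnd n p l R θ φ a a' q h ∧
          RadialPLaplace.SolvesNonDiv p R φ a h w ∨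
        RadialPLaplace.CondNd n p l R θ φ a a' q h ∧
          RadialPLaplace.SolvesDiv p R φ a h w) →
      ∀ x ∈ Metric.ball (0 : EuclideanSpace ℝ (Fin n)) R, w x = 0) ∧
    (0 < volume {τ ∈ Ioo 0 R | h τ 0 0 ≠ 0} →
      ¬ ∃ w : EuclideanSpace ℝ (Fin n) → ℝ,
        RadialPLaplace.IsAdmissible p R w ∧
        (RadialPLaplace.CondNnd n p l R θ φ a a' q h ∧
            RadialPLaplace.SolvesNonDiv p R φ a h w ∨
          RadialPLaplace.CondNd n p l R θ φ a a' q h ∧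
            RadialPLaplace.SolvesDiv p R φ a h w)) := by
  have hn0 : 0 < n := by omega
  constructor
  · intro w hw hsol x hx
    have hxR : ‖x‖ < R := by simpa using hx
    obtain ⟨u, y, hu⟩ := hw.exists_profile hn0 ((norm_nonneg x).trans_lt hxR)
    obtain ⟨v, hv⟩ := RadialPLaplace.exists_energyInequality hn hu hsol
    obtain ⟨ρ, hxρ, hρR⟩ := exists_between hxR
    obtain ⟨α, H⟩ := hv ρ ⟨(norm_nonneg x).trans_lt hxρ, hρR⟩
    rw [hu.eq_radial x hx]
    exact H.u_eq_zero _ ⟨norm_nonneg x, hxρ.le⟩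
  · rintro hpos ⟨w, hw, hsol⟩
    have hR : 0 < R := by
      rcases hsol with ⟨hN, -⟩ | ⟨hN, -⟩ <;> exact hN.numbers.R_pos
    obtain ⟨u, y, hu⟩ := hw.exists_profile hn0 hR
    obtain ⟨v, hv⟩ := RadialPLaplace.exists_energyInequality hn hu hsol
    refine hpos.ne' ?_
    -- `(0, R)` is covered by the intervals `(R / (k + 3), R - R / (k + 3))`
    have hk : ∀ k : ℕ, ∀ᵐ τ, τ ∈ Ioo (R / (k + 3)) (R - R / (k + 3)) → h τ 0 0 = 0 := by
      intro k
      have h1 : 0 < R / (k + 3) := by positivity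
      have h2 : R / (k + 3) ≤ R / 3 := by
        gcongr
        linarith [(Nat.cast_nonneg k : (0 : ℝ) ≤ k)]
      obtain ⟨α, H⟩ := hv (R - R / (k + 3)) ⟨by linarith, by linarith⟩
      exact H.ae_h_eq_zero ⟨h1, by linarith⟩
    have hall : ∀ᵐ τ, ¬ (τ ∈ Ioo 0 R ∧ h τ 0 0 ≠ 0) := by
      filter_upwards [ae_all_iff.2 hk] with τ hτ hτ'
      have hlim : Filter.Tendsto (fun k : ℕ => R / ((k : ℝ) + 3)) Filter.atTop (nhds 0) :=
        tendsto_const_nhds.div_atTop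
          (Filter.tendsto_atTop_add_const_right _ _ tendsto_natCast_atTop_atTop)
      obtain ⟨k, hk1, hk2⟩ := ((hlim.eventually_lt_const hτ'.1.1).and
        (hlim.eventually_lt_const (sub_pos.2 hτ'.1.2))).exists
      exact hτ'.2 (hτ k ⟨hk1, by linarith⟩)
    exact measure_eq_zero_iff_ae_notMem.2 hall
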